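/- **Setting.** Let $m,n,k$ be nonnegative integers and let $\Omega\subset\mathbb R^n$ satisfy $\Omega=\operatorname{int}(\overline\Omega)$ (this holds e.g. for every Lipschitz domain). Let $\mathcal M$ be a finite collection of closed polytopes $K$ (finite unions of convex polytopes with nonempty interior, not necessarily convex) of positive volume, with pairwise overlaps of measure zero, such that $\overline\Omega=\bigcup_{K\in\mathcal M}K$. Let $\Sigma$ be a finite collection of faces with pairwise overlaps of zero $(n-1)$-dimensional measure such that $\bigcup_{K}\partial K=\bigcup_{S\in\Sigma}S$. A face $S$ is a closed connected subset, of positive $(n-1)$-dimensional measure, of a hyperplane with fixed unit normal $\nu_S$, and it is of one of two kinds. For an interior face there are cells $K_\pm$ with $S\subset K_+\cap K_-$ whose outer unit normals satisfy $\nu_{K_\pm}=\pm\nu_S$ a.e. on $S$. For a boundary face, $S\subset\partial\Omega$ and there is a cell $K_+$ with $S\subset K_+$ and $\nu_{K_+}=\nu_S$ a.e. on $S$. Let $\Gamma_{\mathrm D}\subset\partial\Omega$, let $\Sigma_{\mathrm D}$ be the set of faces contained in $\Gamma_{\mathrm D}$, and let $\Sigma_{\mathrm N}$ be the set of the other boundary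 faces. On an interior face set $[f]_S=f|_{K_+}-f|_{K_-}$ and $\{f\}_S=(f|_{K_+}+f|_{K_-})/2$; on a boundary face set $[f]_S=\{f\}_S=f|_{K_+}$. **Spaces.** Let $P_k(\mathcal M)$ and $P_k(\Sigma)$ be the piecewise polynomials of degree at most $k$ on the cells and on the faces, let $\Pi_S^k$ be the $L^2(S)$ projection onto $P_k(S)$ (applied componentwise), let $\mathbb M=\mathbb R^{m\times n}$ with the Frobenius product $A:B$, and let $\mathrm D_{\mathrm{pw}}$, $\operatorname{div}_{\mathrm{pw}}$ denote the piecewise gradient and row-wise divergence. Let $V_{\mathrm D}(\mathcal M)$ be the set of $v_h=(v_{\mathcal M},v_\Sigma)\in P_{k+1}(\mathcal M;\mathbb R^m)\times P_k(\Sigma;\mathbb R^m)$ with $v_S:=v_\Sigma|_S=0$ for all $S\in\Sigma_{\mathrm D}$. Let $W_{\mathrm N}(\mathcal M)$ be the set of $\tau_h=(\tau_{\mathcal M},\tau_\Sigma)\in P_k(\mathcal M;\mathbb M)\times P_k(\Sigma;\mathbb R^m)$ with $\tau_S:=\tau_\Sigma|_S=0$ for all $S\in\Sigma_{\mathrm N}$.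 **Reconstructions.** $\mathrm D_hv_h\in P_k(\mathcal M;\mathbb M)$ is the unique solution of $$\int_\Omega \mathrm D_hv_h:\tau_k\,dx=-\int_\Omega v_{\mathcal M}\cdot\operatorname{div}_{\mathrm{pw}}\tau_k\,dx+\sum_{S\in\Sigma}\int_S v_S\cdot[\tau_k\nu_S]_S\,ds\quad\text{for all }\tau_k\in P_k(\mathcal M;\mathbb M).$$ $\operatorname{div}_h\tau_h\in P_k(\mathcal M;\mathbb R^m)$ is the unique solution of $$\int_\Omega \operatorname{div}_h\tau_h\cdot\varphi_k\,dx=-\int_\Omega \mathrm D_{\mathrm{pw}}\varphi_k:\tau_{\mathcal M}\,dx+\sum_{S\in\Sigma}\int_S[\varphi_k]_S\cdot\tau_S\,ds\quad\text{for all }\varphi_k\in P_k(\mathcal M;\mathbb R^m).$$ Let $Z(\mathcal M)$ be the $L^2$ orthogonal complement of $\mathrm D_{\mathrm{pw}}P_{k+1}(\mathcal M;\mathbb R^m)$ in $P_k(\mathcal M;\mathbb M)$ and $\Pi_{Z(\mathcal M)}$ the $L^2$ projection onto it. $\mathcal R_h^*\tau_h\in P_k(\mathcal M;\mathbb M)$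 is the unique element with $\Pi_{Z(\mathcal M)}\mathcal R_h^*\tau_h=\Pi_{Z(\mathcal M)}\tau_{\mathcal M}$ and $$\int_\Omega\mathcal R_h^*\tau_h:\mathrm D_{\mathrm{pw}}w\,dx=-\int_\Omega w\cdot\operatorname{div}_h\tau_h\,dx+\sum_{S\in\Sigma}\int_S[w]_S\cdot\tau_S\,ds\quad\text{for all }w\in P_{k+1}(\mathcal M;\mathbb R^m).$$ **Lemma (discrete integration by parts).** Any $v_h=(v_{\mathcal M},v_\Sigma)\in V_{\mathrm D}(\mathcal M)$ and $\tau_h=(\tau_{\mathcal M},\tau_\Sigma)\in W_{\mathrm N}(\mathcal M)$ satisfy $$\int_\Omega \mathrm D_hv_h:\mathcal R_h^*\tau_h\,dx=\sum_{S\in\Sigma\setminus\Sigma_{\mathrm D}}\int_S\bigl(v_S-\Pi_S^k\{v_{\mathcal M}\}_S\bigr)\cdot[\mathcal R_h^*\tau_h\,\nu_S]_S\,ds+\sum_{S\in\Sigma\setminus\Sigma_{\mathrm N}}\int_S\Pi_S^k[v_{\mathcal M}]_S\cdot\bigl(\tau_S-\{\mathcal R_h^*\tau_h\,\nu_S\}_S\bigr)\,ds-\int_\Omega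 v_{\mathcal M}\cdot\operatorname{div}_h\tau_h\,dx.$$ -/

import Mathlib

open MeasureTheory

noncomputable section

namespace HHO

/-- The value at `x ∈ ℝⁿ` of a real polynomial in `n` variables. -/
def ev {n : ℕ} (p : MvPolynomial (Fin n) ℝ) (x : EuclideanSpace ℝ (Fin n)) : ℝ :=
  MvPolynomial.eval (fun i => x i) p

/-- `P_k(A)` for a subset `A ⊆ ℝⁿ`: the functions on `A` that are restrictions to `A` of
polynomials of total degree at most `k`. -/
def PolyOn {n : ℕ} (k : ℕ) (A : Set (EuclideanSpace ℝ (Fin n))) : Set (A → ℝ) :=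
  {f | ∃ p : MvPolynomial (Fin n) ℝ, p.totalDegree ≤ k ∧ ∀ x : A, f x = ev p x}

/-- A (full-dimensional, closed, not necessarily convex) polytope: a finite union of convex hulls
of finite point sets, each with nonempty interior. -/
def IsPolytope {n : ℕ} (K : Set (EuclideanSpace ℝ (Fin n))) : Prop :=
  ∃ s : Finset (Finset (EuclideanSpace ℝ (Fin n))),
    (∀ t ∈ s, (interior (convexHull ℝ (t : Set (EuclideanSpace ℝ (Fin n))))).Nonempty) ∧
    K = ⋃ t ∈ s, convexHull ℝ (t : Set (EuclideanSpace ℝ (Fin n)))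

/-- `ν` is the outer unit normal vector of the polytope `K` at the boundary point `x`: near `x`,
the set `K` is the half-space through `x` from which the unit vector `ν` points outwards. -/
def HasOuterNormal {n : ℕ} (K : Set (EuclideanSpace ℝ (Fin n)))
    (x ν : EuclideanSpace ℝ (Fin n)) : Prop :=
  ‖ν‖ = 1 ∧ ∀ᶠ y in nhds x, (y ∈ K ↔ inner ℝ ν (y - x) ≤ 0)

/-- A polytopal mesh of `Ω ⊆ ℝⁿ`: a finite collection of cells and a finite collection of faces.
The surface measure on a face is the `(n-1)`-dimensional Hausdorff measure `μHE[n-1]`, normalized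
so that it is the Lebesgue measure on hyperplanes. -/
structure Mesh (n : ℕ) (Ω : Set (EuclideanSpace ℝ (Fin n))) where
  /-- the number of cells -/
  N : ℕ
  /-- the number of faces -/
  L : ℕ
  /-- the cells, the elements `K` of the mesh -/
  cell : Fin N → Set (EuclideanSpace ℝ (Fin n))
  cell_polytope : ∀ K, IsPolytope (cell K)
  cell_pos : ∀ K, 0 < volume (cell K)
  cell_overlap : ∀ K K', K ≠ K' → volume (cell K ∩ cell K') = 0
  cell_cover : closure Ω = ⋃ K, cell K
  /-- the faces `S` of the mesh -/
  face : Fin L → Set (EuclideanSpace ℝ (Fin n))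
  face_closed : ∀ S, IsClosed (face S)
  face_connected : ∀ S, IsConnected (face S)
  face_pos : ∀ S, 0 < μHE[n - 1] (face S)
  face_overlap : ∀ S S', S ≠ S' → μHE[n - 1] (face S ∩ face S') = 0
  face_cover : (⋃ K, frontier (cell K)) = ⋃ S, face S
  /-- the unit normal vector `ν_S` of the face `S` -/
  normal : Fin L → EuclideanSpace ℝ (Fin n)
  normal_unit : ∀ S, ‖normal S‖ = 1
  /-- each face lies in a hyperplane with normal vector `ν_S` -/
  face_hyperplane : ∀ S, ∃ c : ℝ, ∀ x ∈ face S, inner ℝ (normal S) x = c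
  /-- the cell `K₊(S)`, out of which `ν_S` points -/
  plus : Fin L → Fin N
  /-- the cell `K₋(S)`, into which `ν_S` points, of an interior face;
  the value is `none` exactly for the boundary faces -/
  minus : Fin L → Option (Fin N)
  face_plus : ∀ S, face S ⊆ cell (plus S)
  face_minus : ∀ S K, minus S = some K → face S ⊆ cell K
  face_boundary : ∀ S, minus S = none → face S ⊆ frontier Ω
  /-- `ν_{K₊}|_S = ν_S` (almost everywhere on `S`) -/
  normal_plus : ∀ S, ∀ᵐ x : face S ∂μHE[n - 1], HasOuterNormal (cell (plus S)) x (normal S)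
  /-- `ν_{K₋}|_S = -ν_S` (almost everywhere on `S`) -/
  normal_minus : ∀ S K, minus S = some K →
    ∀ᵐ x : face S ∂μHE[n - 1], HasOuterNormal (cell K) x (-normal S)

namespace Mesh

variable {n : ℕ} {Ω : Set (EuclideanSpace ℝ (Fin n))} (M : Mesh n Ω)

/-- Piecewise polynomial fields, with components indexed by `ι`: a vector of polynomials for each
cell. (Cells have nonempty interior, so polynomials and polynomial functions on them agree.) -/
abbrev PwField (ι : Type) : Type := Fin M.N → ι → MvPolynomial (Fin n) ℝ

/-- Fields on the faces, with components indexed by `ι`. -/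
abbrev FaceField (ι : Type) : Type := (S : Fin M.L) → ι → M.face S → ℝ

/-- Piecewise polynomials of degree at most `k` with respect to the cells. The choices
`ι = Fin m` and `ι = Fin m × Fin n` give `ℝᵐ`-valued and `ℝ^{m × n}`-valued ones. -/
def cellP (k : ℕ) (ι : Type) : Set (M.PwField ι) :=
  {u | ∀ K i, (u K i).totalDegree ≤ k}

/-- Piecewise polynomials of degree at most `k` with respect to the faces. -/
def faceP (k : ℕ) (ι : Type) : Set (M.FaceField ι) :=
  {v | ∀ S i, v S i ∈ PolyOn k (M.face S)}

/-- The Dirichlet faces: the faces contained in `Γ_D`. -/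
def dirichlet (ΓD : Set (EuclideanSpace ℝ (Fin n))) : Finset (Fin M.L) :=
  Set.Finite.toFinset (Set.toFinite {S | M.face S ⊆ ΓD})

/-- The Neumann faces: the boundary faces that are not Dirichlet faces. -/
def neumann (ΓD : Set (EuclideanSpace ℝ (Fin n))) : Finset (Fin M.L) :=
  Set.Finite.toFinset (Set.toFinite {S | M.minus S = none ∧ S ∉ M.dirichlet ΓD})

/-- The ansatz space `V(M) = P_{k+1}(M; ℝᵐ) × P_k(Σ; ℝᵐ)`. -/
def V (k m : ℕ) : Set (M.PwField (Fin m) × M.FaceField (Fin m)) :=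
  M.cellP (k + 1) (Fin m) ×ˢ M.faceP k (Fin m)

/-- The ansatz space `W(M) = P_k(M; ℝ^{m × n}) × P_k(Σ; ℝᵐ)`. -/
def W (k m : ℕ) : Set (M.PwField (Fin m × Fin n) × M.FaceField (Fin m)) :=
  M.cellP k (Fin m × Fin n) ×ˢ M.faceP k (Fin m)

/-- The subspace `V_D(M)` of `V(M)`: the face component vanishes on Dirichlet faces. -/
def VD (ΓD : Set (EuclideanSpace ℝ (Fin n))) (k m : ℕ) :
    Set (M.PwField (Fin m) × M.FaceField (Fin m)) :=
  {v | v ∈ M.V k m ∧ ∀ S ∈ M.dirichlet ΓD, ∀ i x, v.2 S i x = 0}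

/-- The subspace `W_N(M)` of `W(M)`: the face component vanishes on Neumann faces. -/
def WN (ΓD : Set (EuclideanSpace ℝ (Fin n))) (k m : ℕ) :
    Set (M.PwField (Fin m × Fin n) × M.FaceField (Fin m)) :=
  {τ | τ ∈ M.W k m ∧ ∀ S ∈ M.neumann ΓD, ∀ i x, τ.2 S i x = 0}

/-- The integral over `Ω` of the (Euclidean or Frobenius) scalar product of two piecewise
polynomial fields, that is, the sum of the integrals over the cells. -/
def l2 {ι : Type} [Fintype ι] (u w : M.PwField ι) : ℝ :=
  ∑ K, ∫ x in M.cell K, ∑ i, ev (u K i) x * ev (w K i) x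

/-- The integral over the face `S` of the scalar product of two fields on `S`. -/
def intFace (S : Fin M.L) {ι : Type} [Fintype ι] (f g : ι → M.face S → ℝ) : ℝ :=
  ∫ x : M.face S, ∑ i, f i x * g i x ∂μHE[n - 1]

/-- The piecewise gradient `D_pw v`, with entries `∂_j v_i`. -/
def pwGrad {m : ℕ} (v : M.PwField (Fin m)) : M.PwField (Fin m × Fin n) :=
  fun K ij => MvPolynomial.pderiv ij.2 (v K ij.1)

/-- The piecewise (row-wise) divergence `div_pw τ`, with components `∑_j ∂_j τ_ij`. -/
def pwDiv {m : ℕ} (τ : M.PwField (Fin m × Fin n)) : M.PwField (Fin m) :=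
  fun K i => ∑ j, MvPolynomial.pderiv j (τ K (i, j))

/-- The jump along `S` of a cell-wise quantity: `f|_{K₊} - f|_{K₋}` on an interior face and
`f|_{K₊}` on a boundary face. -/
def jump (S : Fin M.L) (f : Fin M.N → ℝ) : ℝ :=
  match M.minus S with
  | some K => f (M.plus S) - f K
  | none => f (M.plus S)

/-- The average along `S` of a cell-wise quantity: `(f|_{K₊} + f|_{K₋})/2` on an interior face and
`f|_{K₊}` on a boundary face. -/
def avg (S : Fin M.L) (f : Fin M.N → ℝ) : ℝ :=
  match M.minus S with
  | some K => (f (M.plus S) + f K) / 2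
  | none => f (M.plus S)

/-- `[v]_S`, as a vector field on the face `S`. -/
def jumpTr {ι : Type} (v : M.PwField ι) (S : Fin M.L) : ι → M.face S → ℝ :=
  fun i x => M.jump S fun K => ev (v K i) x

/-- `{v}_S`, as a vector field on the face `S`. -/
def avgTr {ι : Type} (v : M.PwField ι) (S : Fin M.L) : ι → M.face S → ℝ :=
  fun i x => M.avg S fun K => ev (v K i) x

/-- `[τ ν_S]_S`, as a vector field on the face `S`. -/
def jumpNormal {m : ℕ} (τ : M.PwField (Fin m × Fin n)) (S : Fin M.L) :
    Fin m → M.face S → ℝ :=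
  fun i x => M.jump S fun K => ∑ j, ev (τ K (i, j)) x * M.normal S j

/-- `{τ ν_S}_S`, as a vector field on the face `S`. -/
def avgNormal {m : ℕ} (τ : M.PwField (Fin m × Fin n)) (S : Fin M.L) :
    Fin m → M.face S → ℝ :=
  fun i x => M.avg S fun K => ∑ j, ev (τ K (i, j)) x * M.normal S j

/-- `q` is an `L²` projection onto `P_k(S)` of the function `f` on the face `S`. -/
def IsFaceProj (k : ℕ) (S : Fin M.L) (f q : M.face S → ℝ) : Prop :=
  q ∈ PolyOn k (M.face S) ∧
    ∀ r ∈ PolyOn k (M.face S), ∫ x, q x * r x ∂μHE[n - 1] = ∫ x, f x * r x ∂μHE[n - 1]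

/-- The `L²` projection `Π_S^k` onto `P_k(S)`, applied to each component. -/
def faceProj (k : ℕ) (S : Fin M.L) {ι : Type} (f : ι → M.face S → ℝ) : ι → M.face S → ℝ :=
  fun i => Classical.epsilon (M.IsFaceProj k S (f i))

/-- The defining property of the gradient reconstruction `G = D_h v_h`. -/
def IsGradRec (k : ℕ) {m : ℕ} (v : M.PwField (Fin m) × M.FaceField (Fin m))
    (G : M.PwField (Fin m × Fin n)) : Prop :=
  G ∈ M.cellP k (Fin m × Fin n) ∧ ∀ τ ∈ M.cellP k (Fin m × Fin n),
    M.l2 G τ = -M.l2 v.1 (M.pwDiv τ) + ∑ S, M.intFace S (v.2 S) (M.jumpNormal τ S)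

/-- The gradient reconstruction `D_h v_h ∈ P_k(M; ℝ^{m × n})`. -/
def gradRec (k : ℕ) {m : ℕ} (v : M.PwField (Fin m) × M.FaceField (Fin m)) :
    M.PwField (Fin m × Fin n) :=
  Classical.epsilon (M.IsGradRec k v)

/-- The defining property of the divergence reconstruction `d = div_h τ_h`. -/
def IsDivRec (k : ℕ) {m : ℕ} (τ : M.PwField (Fin m × Fin n) × M.FaceField (Fin m))
    (d : M.PwField (Fin m)) : Prop :=
  d ∈ M.cellP k (Fin m) ∧ ∀ φ ∈ M.cellP k (Fin m),
    M.l2 d φ = -M.l2 (M.pwGrad φ) τ.1 + ∑ S, M.intFace S (M.jumpTr φ S) (τ.2 S)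

/-- The divergence reconstruction `div_h τ_h ∈ P_k(M; ℝᵐ)`. -/
def divRec (k : ℕ) {m : ℕ} (τ : M.PwField (Fin m × Fin n) × M.FaceField (Fin m)) :
    M.PwField (Fin m) :=
  Classical.epsilon (M.IsDivRec k τ)

/-- `Z(M)`: the `L²` orthogonal complement of `D_pw P_{k+1}(M; ℝᵐ)` in `P_k(M; ℝ^{m × n})`. -/
def Z (k m : ℕ) : Set (M.PwField (Fin m × Fin n)) :=
  {z | z ∈ M.cellP k (Fin m × Fin n) ∧
    ∀ w ∈ M.cellP (k + 1) (Fin m), M.l2 z (M.pwGrad w) = 0}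

/-- `z` is an `L²` projection of `τ` onto `Z(M)`. -/
def IsProjZ (k : ℕ) {m : ℕ} (τ z : M.PwField (Fin m × Fin n)) : Prop :=
  z ∈ M.Z k m ∧ ∀ ζ ∈ M.Z k m, M.l2 z ζ = M.l2 τ ζ

/-- The `L²` projection `Π_{Z(M)}` onto `Z(M)`. -/
def projZ (k : ℕ) {m : ℕ} (τ : M.PwField (Fin m × Fin n)) : M.PwField (Fin m × Fin n) :=
  Classical.epsilon (M.IsProjZ k τ)

/-- The defining properties of the dual potential reconstruction `R = R_h^* τ_h`. -/
def IsDualRec (k : ℕ) {m : ℕ} (τ : M.PwField (Fin m × Fin n) × M.FaceField (Fin m))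
    (R : M.PwField (Fin m × Fin n)) : Prop :=
  R ∈ M.cellP k (Fin m × Fin n) ∧
    (∀ w ∈ M.cellP (k + 1) (Fin m), M.l2 R (M.pwGrad w) =
      -M.l2 w (M.divRec k τ) + ∑ S, M.intFace S (M.jumpTr w S) (τ.2 S)) ∧
    M.projZ k R = M.projZ k τ.1

/-- The dual potential reconstruction `R_h^* τ_h ∈ P_k(M; ℝ^{m × n})`. -/
def dualRec (k : ℕ) {m : ℕ} (τ : M.PwField (Fin m × Fin n) × M.FaceField (Fin m)) :
    M.PwField (Fin m × Fin n) :=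
  Classical.epsilon (M.IsDualRec k τ)

end Mesh

end HHO

end

/-! Write $R=\mathcal R_h^*\tau_h$. Testing the definition of $\mathrm D_hv_h$ with $R$ produces
$-\int_\Omega v_{\mathcal M}\cdot\operatorname{div}_{\mathrm{pw}}R$. Piecewise integration by parts
turns this into $\int_\Omega \mathrm D_{\mathrm{pw}}v_{\mathcal M}:R$ minus the face integrals of
$[v_{\mathcal M}\cdot R\nu_S]_S$, and the definition of $R$ tested with $w=v_{\mathcal M}$ replaces
the gradient term by $\operatorname{div}_h\tau_h$ and $\tau_S$. What remains is an identity face by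
face. The projections drop out because they are paired with $R\nu_S$ and $\tau_S$, which have degree
at most $k$ on $S$. On interior faces one uses $[ab]=[a]\{b\}+\{a\}[b]$. On Dirichlet faces $v_S=0$,
on Neumann faces $\tau_S=0$, and the single trace product is read as $[a]\{b\}$ or $\{a\}[b]$
accordingly.

Two facts carry the weight. The first is Gauss' theorem on a nonconvex polytopal cell
(`setIntegral_fderiv_eq_sum`, `l2_pwGrad_add_l2_pwDiv`). Along almost every line in a direction
transversal to all faces, the indicator of the cell is a signed sum of indicators of half-lines
ending on the faces; integrating a directional derivative over these half-lines gives the face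
integrals. The cell must be a half-space near almost every point of its own faces and must meet the
other faces only in null sets. The latter (`measure_face_inter_cell`) uses
$\Omega=\operatorname{int}\overline\Omega$ on boundary faces.

The second is that the reconstructions exist, so that the choices made by `Classical.epsilon` have
their defining properties. This is linear algebra (`exists_bilin_eq`); for $\mathcal R_h^*$ it needs
a compatibility condition on piecewise constants, which is the definition of $\operatorname{div}_h$
(`isDualRec_dualRec`). -/

noncomputable section

namespace HHO

open Module Set

set_option linter.unusedSectionVars false

/-! ### Hausdorff measure on hyperplanes and Fubini along a transversal direction -/

section Hyperplane

variable {E : Type*} [NormedAddCommGroup E] [InnerProductSpace ℝ E] [FiniteDimensional ℝ E]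
  [MeasurableSpace E] [BorelSpace E]

/-- The isometric parametrization of the hyperplane `⟪ν, x⟫ = c` by the orthogonal complement
of its unit normal `ν`. -/
def hyp (ν : E) (c : ℝ) (h : (ℝ ∙ ν)ᗮ) : E := (h : E) + c • ν

lemma isometry_hyp (ν : E) (c : ℝ) : Isometry (hyp ν c) :=
  Isometry.of_dist_eq fun x y => by simp [hyp, Subtype.dist_eq]

lemma inner_coe_orthogonal {ν : E} (h : (ℝ ∙ ν)ᗮ) : inner ℝ ν (h : E) = 0 :=
  Submodule.mem_orthogonal_singleton_iff_inner_right.1 h.2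

lemma inner_hyp {ν : E} (hν : ‖ν‖ = 1) (c : ℝ) (h : (ℝ ∙ ν)ᗮ) : inner ℝ ν (hyp ν c h) = c := by
  simp [hyp, inner_add_right, inner_smul_right, inner_coe_orthogonal, hν]

lemma range_hyp {ν : E} (hν : ‖ν‖ = 1) (c : ℝ) : range (hyp ν c) = {x | inner ℝ ν x = c} := by
  ext x
  constructor
  · rintro ⟨h, rfl⟩
    exact inner_hyp hν c h
  · intro hx
    refine ⟨⟨x - c • ν, ?_⟩, by simp [hyp]⟩
    rw [Submodule.mem_orthogonal_singleton_iff_inner_right, inner_sub_right, inner_smul_right,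
      real_inner_self_eq_norm_sq, hν, hx]
    ring

lemma finrank_orthogonal_unit {ν : E} (hν : ‖ν‖ = 1) :
    finrank ℝ (ℝ ∙ ν)ᗮ = finrank ℝ E - 1 := by
  have h0 : ν ≠ 0 := by
    rintro rfl
    simp at hν
  have h := Submodule.finrank_add_finrank_orthogonal (ℝ ∙ ν)
  rw [finrank_span_singleton h0] at h
  omega

lemma map_hyp_volume {ν : E} (hν : ‖ν‖ = 1) (c : ℝ) :
    (volume : Measure (ℝ ∙ ν)ᗮ).map (hyp ν c) =
      (μHE[finrank ℝ E - 1] : Measure E).restrict {x | inner ℝ ν x = c} := by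
  rw [← range_hyp hν c, ← (isometry_hyp ν c).map_euclideanHausdorffMeasure,
    ← InnerProductSpace.euclideanHausdorffMeasure_eq_volume, finrank_orthogonal_unit hν]

lemma measurableEmbedding_hyp (ν : E) (c : ℝ) : MeasurableEmbedding (hyp ν c) :=
  (isometry_hyp ν c).isClosedEmbedding.measurableEmbedding

lemma restrict_eq_map_hyp {ν : E} (hν : ‖ν‖ = 1) {c : ℝ} {S : Set E}
    (hS : MeasurableSet S) (hSc : S ⊆ {x | inner ℝ ν x = c}) :
    (μHE[finrank ℝ E - 1] : Measure E).restrict S =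
      ((volume : Measure (ℝ ∙ ν)ᗮ).restrict (hyp ν c ⁻¹' S)).map (hyp ν c) := by
  rw [← (measurableEmbedding_hyp ν c).restrict_map, map_hyp_volume hν,
    Measure.restrict_restrict hS, inter_eq_left.2 hSc]

lemma setIntegral_hyp {ν : E} (hν : ‖ν‖ = 1) {c : ℝ} {S : Set E}
    (hS : MeasurableSet S) (hSc : S ⊆ {x | inner ℝ ν x = c}) (f : E → ℝ) :
    ∫ x in S, f x ∂μHE[finrank ℝ E - 1] = ∫ h in hyp ν c ⁻¹' S, f (hyp ν c h) := by
  rw [restrict_eq_map_hyp hν hS hSc, (measurableEmbedding_hyp ν c).integral_map]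

lemma measure_hyp {ν : E} (hν : ‖ν‖ = 1) {c : ℝ} {S : Set E}
    (hSc : S ⊆ {x | inner ℝ ν x = c}) :
    (μHE[finrank ℝ E - 1] : Measure E) S = volume (hyp ν c ⁻¹' S) := by
  rw [← (measurableEmbedding_hyp ν c).map_apply, map_hyp_volume hν, Measure.restrict_apply',
    inter_eq_left.2 hSc]
  exact (isClosed_eq (by fun_prop) continuous_const).measurableSet

lemma measure_hyperplane_lt_top {ν : E} (hν : ‖ν‖ = 1) {c : ℝ} {S : Set E}
    (hSc : S ⊆ {x | inner ℝ ν x = c}) (hb : Bornology.IsBounded S) :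
    (μHE[finrank ℝ E - 1] : Measure E) S < ⊤ := by
  rw [measure_hyp hν hSc]
  exact ((isometry_hyp ν c).antilipschitz.isBounded_preimage hb).measure_lt_top

/-- The coordinates `(h, s) ↦ hyp ν c h + s • v`, for a direction `v` transversal to the
hyperplane, have Jacobian `|⟪ν, v⟫|`. -/
lemma map_hyp_add_smul {ν : E} (hν : ‖ν‖ = 1) (c : ℝ) {v : E} (hv : inner ℝ ν v ≠ 0) :
    (volume : Measure ((ℝ ∙ ν)ᗮ × ℝ)).map (fun p => hyp ν c p.1 + p.2 • v) =
      ENNReal.ofReal |(inner ℝ ν v)⁻¹| • (volume : Measure E) := by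
  set a := inner ℝ ν v with ha
  let w : (ℝ ∙ ν)ᗮ := ⟨v - a • ν, by
    rw [Submodule.mem_orthogonal_singleton_iff_inner_right, inner_sub_right, inner_smul_right,
      real_inner_self_eq_norm_sq, hν, ha]
    ring⟩
  -- With $v=w+a\nu$ and $w\perp\nu$, the map factors into the scaling $s\mapsto as$, a shear along
  -- $w$ and the orthogonal decomposition. Only the scaling changes the volume.
  have h1 : (volume : Measure ((ℝ ∙ ν)ᗮ × ℝ)).map (Prod.map id (a * ·)) =
      ENNReal.ofReal |a⁻¹| • (volume : Measure ((ℝ ∙ ν)ᗮ × ℝ)) := by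
    rw [Measure.volume_eq_prod, ← Measure.map_prod_map _ _ measurable_id (by fun_prop),
      Measure.map_id, Real.map_volume_mul_left hv, Measure.prod_smul_right]
  have h2 : MeasurePreserving (fun p : (ℝ ∙ ν)ᗮ × ℝ => (p.1 + (a⁻¹ * p.2) • w, p.2)) := by
    have h : MeasurePreserving (fun p : ℝ × (ℝ ∙ ν)ᗮ => (p.1, p.2 + (a⁻¹ * p.1) • w)) :=
      (MeasurePreserving.id volume).skew_product (g := fun t h => h + (a⁻¹ * t) • w) (by fun_prop)
        (Filter.Eventually.of_forall fun t => (measurePreserving_add_right volume _).map_eq)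
    exact (Measure.measurePreserving_swap.comp h).comp Measure.measurePreserving_swap
  have h3 : MeasurePreserving (fun p : (ℝ ∙ ν)ᗮ × ℝ => hyp ν c p.1 + p.2 • ν) := by
    have e := ((ℝ ∙ ν).measurePreserving_measurableEquivProd (c • ν)).symm
    rw [InnerProductSpace.euclideanHausdorffMeasure_eq_volume] at e
    have f := (LinearIsometryEquiv.toSpanUnitSingleton ν hν).measurePreserving
    convert e.comp ((f.prod (MeasurePreserving.id _)).comp Measure.measurePreserving_swap) using 1
    · ext1 p
      simp [hyp]
      abel
    · rfl
  have := h3.comp h2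
  have key : (fun p : (ℝ ∙ ν)ᗮ × ℝ => hyp ν c p.1 + p.2 • v) =
      ((fun p : (ℝ ∙ ν)ᗮ × ℝ => hyp ν c p.1 + p.2 • ν) ∘
        fun p : (ℝ ∙ ν)ᗮ × ℝ => (p.1 + (a⁻¹ * p.2) • w, p.2)) ∘ Prod.map id (a * ·) := by
    ext1 p
    simp only [Function.comp, Prod.map, hyp, w, id, Submodule.coe_add, Submodule.coe_smul]
    rw [inv_mul_cancel_left₀ hv]
    module
  rw [key, ← Measure.map_map this.measurable (by fun_prop), h1, Measure.map_smul, this.map_eq]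

lemma continuous_hyp_add_smul (ν : E) (c : ℝ) (v : E) :
    Continuous fun p : (ℝ ∙ ν)ᗮ × ℝ => hyp ν c p.1 + p.2 • v := by
  unfold hyp
  fun_prop

/-- The parameter `s` at which the line `x + s • v` hits the hyperplane `⟪ν, x⟫ = c`. -/
def hitTime (ν : E) (c : ℝ) (v x : E) : ℝ := (c - inner ℝ ν x) / inner ℝ ν v

/-- The projection along `v` onto the hyperplane `⟪ν, x⟫ = c`. -/
def hit (ν : E) (c : ℝ) (v x : E) : E := x + hitTime ν c v x • v

lemma continuous_hitTime (ν : E) (c : ℝ) (v : E) : Continuous (hitTime ν c v) := by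
  unfold hitTime
  fun_prop

lemma continuous_hit (ν : E) (c : ℝ) (v : E) : Continuous (hit ν c v) :=
  continuous_id.add ((continuous_hitTime ν c v).smul continuous_const)

lemma hitTime_add_smul {ν v : E} (hv : inner ℝ ν v ≠ 0) (c : ℝ) (x : E) (t : ℝ) :
    hitTime ν c v (x + t • v) = hitTime ν c v x - t := by
  simp only [hitTime, inner_add_right, inner_smul_right]
  field_simp
  ring

lemma hit_add_smul {ν v : E} (hv : inner ℝ ν v ≠ 0) (c : ℝ) (x : E) (t : ℝ) :
    hit ν c v (x + t • v) = hit ν c v x := by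
  rw [hit, hitTime_add_smul hv, hit]
  module

lemma hitTime_of_mem {ν : E} {c : ℝ} (v : E) {x : E} (hx : inner ℝ ν x = c) :
    hitTime ν c v x = 0 := by
  simp [hitTime, hx]

lemma hit_of_mem {ν : E} {c : ℝ} (v : E) {x : E} (hx : inner ℝ ν x = c) : hit ν c v x = x := by
  simp [hit, hitTime_of_mem v hx]

lemma eq_hitTime_of_mem {ν v : E} (hv : inner ℝ ν v ≠ 0) {c : ℝ} {x : E} {t : ℝ}
    (h : inner ℝ ν (x + t • v) = c) : t = hitTime ν c v x := by
  have := hitTime_of_mem v h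
  rw [hitTime_add_smul hv] at this
  linarith

lemma integral_hyp_add_smul {ν : E} (hν : ‖ν‖ = 1) (c : ℝ) {v : E} (hv : inner ℝ ν v ≠ 0)
    {F : E → ℝ} (hF : Integrable F) :
    ∫ x, F x = |inner ℝ ν v| * ∫ h : (ℝ ∙ ν)ᗮ, ∫ s : ℝ, F (hyp ν c h + s • v) := by
  have hm := map_hyp_add_smul hν c hv
  have hc := (continuous_hyp_add_smul ν c v).measurable
  have hF' : Integrable F ((volume : Measure ((ℝ ∙ ν)ᗮ × ℝ)).map
      fun p => hyp ν c p.1 + p.2 • v) := by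
    rw [hm]
    exact hF.smul_measure ENNReal.ofReal_ne_top
  have h1 := integral_map hc.aemeasurable hF'.aestronglyMeasurable
  rw [hm, integral_smul_measure, ENNReal.toReal_ofReal (abs_nonneg _)] at h1
  rw [← integral_prod (fun p : (ℝ ∙ ν)ᗮ × ℝ => F (hyp ν c p.1 + p.2 • v))
    (hF'.comp_measurable hc), ← Measure.volume_eq_prod, ← h1, smul_eq_mul, abs_inv,
    mul_inv_cancel_left₀ (abs_ne_zero.2 hv)]

/-- In the coordinates of `map_hyp_add_smul` the set is a cylinder over `B`. This lets exceptional
null sets on a face be ignored for almost every line. As `B` need not be measurable, it is enlarged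
to a measurable null set. -/
lemma volume_hit_preimage_null {ν : E} (hν : ‖ν‖ = 1) {c : ℝ} {v : E} (hv : inner ℝ ν v ≠ 0)
    {B : Set E} (hBc : B ⊆ {x | inner ℝ ν x = c})
    (hB : (μHE[finrank ℝ E - 1] : Measure E) B = 0) : volume {x | hit ν c v x ∈ B} = 0 := by
  have hB' : (volume.map (hyp ν c)) B = 0 := by
    rw [(measurableEmbedding_hyp ν c).map_apply, ← measure_hyp hν hBc, hB]
  obtain ⟨B', hBB', hmeas, hnull⟩ := exists_measurable_superset_of_null hB'
  rw [(measurableEmbedding_hyp ν c).map_apply] at hnull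
  have hmeas' : MeasurableSet {x | hit ν c v x ∈ B'} := (continuous_hit ν c v).measurable hmeas
  have h := congrArg (fun μ => μ {x | hit ν c v x ∈ B'}) (map_hyp_add_smul hν c hv)
  simp only [Measure.smul_apply, smul_eq_mul] at h
  rw [Measure.map_apply (continuous_hyp_add_smul ν c v).measurable hmeas'] at h
  have h0 : (volume : Measure ((ℝ ∙ ν)ᗮ × ℝ)) ((fun p => hyp ν c p.1 + p.2 • v) ⁻¹'
      {x | hit ν c v x ∈ B'}) = 0 := by
    have : ((fun p : (ℝ ∙ ν)ᗮ × ℝ => hyp ν c p.1 + p.2 • v) ⁻¹' {x | hit ν c v x ∈ B'}) =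
        Prod.fst ⁻¹' (hyp ν c ⁻¹' B') := by
      ext p
      simp [hit_add_smul hv, hit_of_mem v (inner_hyp hν c p.1)]
    rw [this]
    exact Measure.quasiMeasurePreserving_fst.preimage_null hnull
  rw [h0, eq_comm, mul_eq_zero] at h
  refine measure_mono_null (t := {x | hit ν c v x ∈ B'}) (fun x hx => hBB' hx)
    (h.resolve_left ?_)
  simpa using hv

lemma volume_hyperplane {ν : E} (hν : ‖ν‖ = 1) (c : ℝ) : volume {x : E | inner ℝ ν x = c} = 0 := by
  have h := Measure.addHaar_affineSubspace (volume : Measure E)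
    (AffineSubspace.mk' (c • ν) (ℝ ∙ ν)ᗮ) ?_
  · convert h using 2
    ext x
    simp [AffineSubspace.mem_mk', Submodule.mem_orthogonal_singleton_iff_inner_right,
      inner_sub_right, inner_smul_right, hν, sub_eq_zero]
  · intro h
    have h2 : c • ν + ν ∈ AffineSubspace.mk' (c • ν) (ℝ ∙ ν)ᗮ := by
      rw [h]; trivial
    simp [AffineSubspace.mem_mk', Submodule.mem_orthogonal_singleton_iff_inner_right, hν] at h2

/-- The shadow `S - [0, ∞) v` of a subset `S` of the hyperplane `⟪ν, x⟫ = c`. -/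
def shadow (ν : E) (c : ℝ) (v : E) (S : Set E) : Set E :=
  {x | hit ν c v x ∈ S ∧ 0 ≤ hitTime ν c v x}

lemma measurableSet_shadow (ν : E) (c : ℝ) (v : E) {S : Set E} (hS : MeasurableSet S) :
    MeasurableSet (shadow ν c v S) :=
  ((continuous_hit ν c v).measurable hS).inter
    (measurableSet_le measurable_const (continuous_hitTime ν c v).measurable)

lemma integrable_fderiv_apply {f : E → ℝ} (hf : ContDiff ℝ 1 f) (hf' : HasCompactSupport f)
    (v : E) : Integrable fun x => fderiv ℝ f x v :=
  ((hf.continuous_fderiv one_ne_zero).clm_apply continuous_const).integrable_of_hasCompactSupport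
    (hf'.fderiv_apply ℝ v)

/-- The integral of a directional derivative over the shadow of a face. -/
lemma integral_shadow {ν : E} (hν : ‖ν‖ = 1) {c : ℝ} {v : E} (hv : inner ℝ ν v ≠ 0)
    {S : Set E} (hS : MeasurableSet S) (hSc : S ⊆ {x | inner ℝ ν x = c})
    {f : E → ℝ} (hf : ContDiff ℝ 1 f) (hf' : HasCompactSupport f) :
    ∫ x in shadow ν c v S, fderiv ℝ f x v =
      |inner ℝ ν v| * ∫ x in S, f x ∂μHE[finrank ℝ E - 1] := by
  have hm := measurableSet_shadow ν c v hS
  rw [← integral_indicator hm, integral_hyp_add_smul hν c hv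
    ((integrable_fderiv_apply hf hf' v).indicator hm), setIntegral_hyp hν hS hSc,
    ← integral_indicator ((measurableEmbedding_hyp ν c).measurable hS)]
  congr 2
  ext1 h
  have hv0 : v ≠ 0 := by
    rintro rfl
    simp at hv
  have hline : ∀ s : ℝ, HasDerivAt (fun s : ℝ => hyp ν c h + s • v) v s := fun s => by
    simpa using ((hasDerivAt_id s).smul_const v).const_add (hyp ν c h)
  have hd : ∀ s : ℝ, HasDerivAt (fun s : ℝ => f (hyp ν c h + s • v))
      (fderiv ℝ f (hyp ν c h + s • v) v) s := fun s =>
    ((hf.differentiable one_ne_zero _).hasFDerivAt).comp_hasDerivAt s (hline s)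
  have hcs : HasCompactSupport fun s : ℝ => f (hyp ν c h + s • v) :=
    hf'.comp_isClosedEmbedding ((Homeomorph.addLeft (hyp ν c h)).isClosedEmbedding.comp
      (isClosedEmbedding_smul_left hv0))
  have hcd : ContDiff ℝ 1 fun s : ℝ => f (hyp ν c h + s • v) := by fun_prop
  have hmem : ∀ s : ℝ, hyp ν c h + s • v ∈ shadow ν c v S ↔ hyp ν c h ∈ S ∧ s ≤ 0 := fun s => by
    simp [shadow, hit_add_smul hv, hitTime_add_smul hv, hit_of_mem v (inner_hyp hν c h),
      hitTime_of_mem v (inner_hyp hν c h)]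
  by_cases hhS : hyp ν c h ∈ S
  · rw [indicator_of_mem (show h ∈ hyp ν c ⁻¹' S from hhS)]
    -- On each line that hits `S`, the shadow is the half-line $s\le 0$, and the fundamental theorem
    -- of calculus leaves the value at the endpoint.
    have := hcs.integral_Iic_deriv_eq hcd 0
    simp only [zero_smul, add_zero] at this
    rw [← this, ← integral_indicator measurableSet_Iic]
    congr 1
    ext s
    simp only [indicator, hmem, hhS, true_and, mem_Iic, (hd s).deriv]
  · rw [indicator_of_notMem (show h ∉ hyp ν c ⁻¹' S from hhS)]
    simp [indicator, hmem, hhS]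

end Hyperplane


/-! ### Gauss' theorem for sets with flat faces -/

section Gauss

open Filter Topology

variable {E : Type*} [NormedAddCommGroup E] [InnerProductSpace ℝ E] [FiniteDimensional ℝ E]
  [MeasurableSpace E] [BorelSpace E]

/-- Near `x`, either `x` is not a boundary point of `K` and `σ = 0`, or `σ = ±1` and `K` is the
half-space with outer normal `σ ν` at `x`. -/
def LocalHalfSpace (K : Set E) (ν : E) (σ : ℝ) (x : E) : Prop :=
  (σ = 0 ∧ x ∉ frontier K) ∨ (|σ| = 1 ∧ ∀ᶠ y in 𝓝 x, (y ∈ K ↔ σ * inner ℝ ν (y - x) ≤ 0))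

lemma eventually_mem_iff_of_notMem_frontier {K : Set E} {x : E} (hx : x ∉ frontier K) :
    ∀ᶠ y in 𝓝 x, (y ∈ K ↔ x ∈ K) := by
  by_cases hxK : x ∈ K
  · have : x ∈ interior K := by
      by_contra h
      exact hx ⟨subset_closure hxK, h⟩
    filter_upwards [mem_interior_iff_mem_nhds.1 this] with y hy
    simp [hy, hxK]
  · have : x ∉ closure K := fun h => hx ⟨h, fun h' => hxK (interior_subset h')⟩
    filter_upwards [isClosed_closure.isOpen_compl.mem_nhds this] with y hy
    have : y ∉ K := fun h => hy (subset_closure h)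
    simp [this, hxK]

lemma indicator_one_congr {K : Set E} {x y : E} (h : x ∈ K ↔ y ∈ K) :
    K.indicator (1 : E → ℝ) x = K.indicator 1 y := by
  by_cases hy : y ∈ K
  · rw [indicator_of_mem (h.2 hy), indicator_of_mem hy, Pi.one_apply, Pi.one_apply]
  · rw [indicator_of_notMem (mt h.1 hy), indicator_of_notMem hy]

/-- The indicator along the line `t ↦ x + t • v` of the shadow of a face `S`; the endpoint is
included or excluded according to the sign of `κ`. -/
def lineInd (ν : E) (c : ℝ) (v : E) (S : Set E) (κ : ℝ) (x : E) (t : ℝ) : ℝ :=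
  open Classical in
  if hit ν c v x ∈ S ∧ (t < hitTime ν c v x ∨ t = hitTime ν c v x ∧ 0 < κ) then 1 else 0

/-- The only possible jump is at the hitting time, and only if the point hit belongs to `S`. -/
lemma lineInd_eventually_eq {ν : E} {c : ℝ} {v : E} {S : Set E} (κ : ℝ) {x : E} {t : ℝ}
    (h : t = hitTime ν c v x → hit ν c v x ∉ S) :
    ∀ᶠ s in 𝓝 t, lineInd ν c v S κ x s = lineInd ν c v S κ x t := by
  by_cases hS : hit ν c v x ∈ S
  · rcases lt_or_gt_of_ne (fun e => h e hS) with hlt | hgt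
    · filter_upwards [Iio_mem_nhds hlt] with s hs
      simp [lineInd, hS, hlt, mem_Iio.1 hs]
    · filter_upwards [Ioi_mem_nhds hgt] with s hs
      simp [lineInd, hgt.not_gt, (mem_Ioi.1 hs).not_gt, hgt.ne', (mem_Ioi.1 hs).ne']
  · simp [lineInd, hS]

variable {ι : Type*} [Fintype ι]

/-- The indicator of `K` along a line is the signed sum of the indicators of the shadows of
the faces of `K`. -/
lemma indicator_line_eq_sum {K : Set E} (hKb : Bornology.IsBounded K)
    {S : ι → Set E} {ν : ι → E} {c : ι → ℝ} (hSc : ∀ i, S i ⊆ {x | inner ℝ (ν i) x = c i})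
    {σ : ι → ℝ} (hfr : frontier K ⊆ ⋃ i, S i) {v : E} (hv0 : v ≠ 0)
    (hv : ∀ i, inner ℝ (ν i) v ≠ 0) {x : E}
    (hloc : ∀ i, hit (ν i) (c i) v x ∈ S i → LocalHalfSpace K (ν i) (σ i) (hit (ν i) (c i) v x))
    (hov : ∀ i j, i ≠ j → hit (ν i) (c i) v x ∈ S i → hit (ν i) (c i) v x ∉ S j) (t : ℝ) :
    K.indicator 1 (x + t • v) = ∑ i, (σ i * (SignType.sign (inner ℝ (ν i) v) : ℝ)) *
      lineInd (ν i) (c i) v (S i) (σ i * (SignType.sign (inner ℝ (ν i) v) : ℝ)) x t := by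
  set κ : ι → ℝ := fun i => σ i * (SignType.sign (inner ℝ (ν i) v) : ℝ) with hκ
  set D : ℝ → ℝ := fun t => K.indicator 1 (x + t • v) -
    ∑ i, κ i * lineInd (ν i) (c i) v (S i) (κ i) x t with hD
  have hcont : Continuous fun t : ℝ => x + t • v := by fun_prop
  -- Crossing a face changes both sides of the claim by the same amount, so their difference `D` is
  -- locally constant on the connected line. It vanishes far out.
  have hconst : IsLocallyConstant D := by
    rw [IsLocallyConstant.iff_eventually_eq]
    intro t
    have hz : ∀ i, t = hitTime (ν i) (c i) v x → hit (ν i) (c i) v x = x + t • v := fun i h => by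
      rw [hit, ← h]
    have hz' : ∀ i, x + t • v ∈ S i → t = hitTime (ν i) (c i) v x := fun i h =>
      eq_hitTime_of_mem (hv i) (hSc i h)
    have hind : x + t • v ∉ frontier K → ∀ᶠ s in 𝓝 t,
        K.indicator (1 : E → ℝ) (x + s • v) = K.indicator 1 (x + t • v) := fun h => by
      filter_upwards [hcont.continuousAt.eventually (eventually_mem_iff_of_notMem_frontier h)]
        with s hs
      exact indicator_one_congr hs
    by_cases h : ∃ i, x + t • v ∈ S i
    · obtain ⟨i, hi⟩ := h
      have hti := hz' i hi
      have hhit := hz i hti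
      have hiS : hit (ν i) (c i) v x ∈ S i := hhit ▸ hi
      have hrest : ∀ᶠ s in 𝓝 t, ∀ j, j ≠ i →
          lineInd (ν j) (c j) v (S j) (κ j) x s = lineInd (ν j) (c j) v (S j) (κ j) x t := by
        rw [eventually_all]
        intro j
        by_cases hj : j = i
        · simp [hj]
        · filter_upwards [lineInd_eventually_eq (κ j) (fun e hjS => hov j i hj hjS
            (by rw [hz j e]; exact hi))] with s hs _ using hs
      have hsuff : (∀ᶠ s in 𝓝 t, K.indicator (1 : E → ℝ) (x + s • v) -
            κ i * lineInd (ν i) (c i) v (S i) (κ i) x s =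
          K.indicator 1 (x + t • v) - κ i * lineInd (ν i) (c i) v (S i) (κ i) x t) →
          ∀ᶠ s in 𝓝 t, D s = D t := fun h => by
        classical
        filter_upwards [h, hrest] with s hs hs'
        simp only [hD]
        rw [← Finset.add_sum_erase _ _ (Finset.mem_univ i),
          ← Finset.add_sum_erase _ _ (Finset.mem_univ i),
          Finset.sum_congr rfl fun j hj => by rw [hs' j (Finset.ne_of_mem_erase hj)]]
        linarith
      apply hsuff
      rcases hloc i hiS with ⟨hσ, hnf⟩ | ⟨hσ, hhalf⟩
      · rw [hhit] at hnf
        filter_upwards [hind hnf] with s hs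
        simp [hs, hκ, hσ]
      · rw [hhit] at hhalf
        have hline := hcont.continuousAt.eventually hhalf
        have hmem : ∀ᶠ s in 𝓝 t, (x + s • v ∈ K ↔ κ i * (s - t) ≤ 0) := by
          filter_upwards [hline] with s hs
          rw [hs, show x + s • v - (x + t • v) = (s - t) • v by module, inner_smul_right, hκ]
          have ha : inner ℝ (ν i) v =
              |inner ℝ (ν i) v| * (SignType.sign (inner ℝ (ν i) v) : ℝ) := (abs_mul_sign _).symm
          have hpos : 0 < |inner ℝ (ν i) v| := abs_pos.2 (hv i)
          have : σ i * ((s - t) * inner ℝ (ν i) v) = |inner ℝ (ν i) v| *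
              (σ i * (SignType.sign (inner ℝ (ν i) v) : ℝ) * (s - t)) := by
            conv_lhs => rw [ha]
            ring
          rw [this]
          refine ⟨fun h => ?_, mul_nonpos_of_nonneg_of_nonpos hpos.le⟩
          by_contra! h'
          exact h.not_gt (mul_pos hpos h')
        have hκ1 : κ i = 1 ∨ κ i = -1 := by
          rcases (abs_eq zero_le_one).1 hσ with h | h <;>
          rcases (hv i).lt_or_gt with h' | h' <;> simp [hκ, h, h']
        -- If `κ i = 1` the line leaves `K` at `t`, and the closed half-line cancels the indicator
        -- of `K`. If `κ i = -1` it enters `K`, and the open half-line is complementary to `K`, so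
        -- the two add up to 1. This is why the endpoint convention of `lineInd` depends on the
        -- sign.
        have hval : ∀ s, (x + s • v ∈ K ↔ κ i * (s - t) ≤ 0) → K.indicator (1 : E → ℝ) (x + s • v) -
            κ i * lineInd (ν i) (c i) v (S i) (κ i) x s = if κ i = 1 then 0 else 1 := by
          intro s hs
          rcases hκ1 with h | h
          · simp only [indicator, hs, h, lineInd, hiS, ← hti, true_and, Pi.one_apply, one_mul,
              zero_lt_one, and_true, ← le_iff_lt_or_eq, sub_nonpos, if_true, sub_self]
          · rcases lt_or_ge s t with hst | hst
            · have : ¬ (-1 * (s - t) ≤ 0) := by linarith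
              simp only [indicator, hs, h, lineInd, hiS, ← hti, true_and, this, hst, if_true,
                if_false, true_or]
              norm_num
            · have : (-1 * (s - t) ≤ 0) := by linarith
              have h0 : ¬ ((0:ℝ) < -1) := by norm_num
              simp only [indicator, hs, h, lineInd, hiS, ← hti, this, hst.not_gt, if_true,
                if_false, h0, and_false, or_false, Pi.one_apply]
              norm_num
        filter_upwards [hmem] with s hs
        rw [hval s hs, hval t hmem.self_of_nhds]
    · push Not at h
      have hnf : x + t • v ∉ frontier K := fun hf => by
        obtain ⟨i, hi⟩ := mem_iUnion.1 (hfr hf)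
        exact h i hi
      have hall : ∀ᶠ s in 𝓝 t, ∀ i,
          lineInd (ν i) (c i) v (S i) (κ i) x s = lineInd (ν i) (c i) v (S i) (κ i) x t :=
        eventually_all.2 fun i => lineInd_eventually_eq (κ i) fun e => by
          rw [hz i e]; exact h i
      filter_upwards [hind hnf, hall] with s hs hs'
      simp only [hD, hs, hs']
  obtain ⟨R, hR⟩ := hKb.subset_closedBall 0
  -- For large `s` the point has left the bounded set `K` and passed all hyperplanes, so every term
  -- of `D` is zero.
  have hfar : ∀ᶠ s : ℝ in atTop, x + s • v ∉ K := by
    filter_upwards [eventually_gt_atTop ((R + ‖x‖) / ‖v‖), eventually_ge_atTop 0] with s hs hs0 hK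
    have h1 : ‖x + s • v‖ ≤ R := by simpa using hR hK
    rw [div_lt_iff₀ (norm_pos_iff.2 hv0)] at hs
    have h2 : ‖s • v‖ ≤ ‖x + s • v‖ + ‖x‖ := by
      simpa using norm_sub_le (x + s • v) x
    rw [norm_smul, Real.norm_of_nonneg hs0] at h2
    linarith
  have hfar' : ∀ᶠ s : ℝ in atTop, ∀ i, hitTime (ν i) (c i) v x < s :=
    eventually_all.2 fun i => eventually_gt_atTop _
  obtain ⟨s, hs, hs'⟩ := (hfar.and hfar').exists
  have hDs : D s = 0 := by
    simp [hD, hs, lineInd, (hs' _).not_gt, (hs' _).ne']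
  have := hconst.apply_eq_of_preconnectedSpace t s
  rw [hDs] at this
  exact sub_eq_zero.1 this

/-- Almost every line avoids the overlaps and the bad points of the faces, so
`indicator_line_eq_sum` at `t = 0` splits the integral over `K` into shadows. The sign in each
coefficient combines with the factor $|\langle\nu_i,v\rangle|$ of `integral_shadow` to
$\langle\nu_i,v\rangle$. -/
lemma setIntegral_fderiv_eq_sum_of_transversal {K : Set E} (hK : MeasurableSet K)
    (hKb : Bornology.IsBounded K) {S : ι → Set E} (hS : ∀ i, IsClosed (S i))
    {ν : ι → E} (hν : ∀ i, ‖ν i‖ = 1) {c : ι → ℝ}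
    (hSc : ∀ i, S i ⊆ {x | inner ℝ (ν i) x = c i}) {σ : ι → ℝ} (hfr : frontier K ⊆ ⋃ i, S i)
    (hov : ∀ i j, i ≠ j → (μHE[finrank ℝ E - 1] : Measure E) (S i ∩ S j) = 0)
    (hloc : ∀ i, (μHE[finrank ℝ E - 1] : Measure E)
      {x ∈ S i | ¬ LocalHalfSpace K (ν i) (σ i) x} = 0)
    {f : E → ℝ} (hf : ContDiff ℝ 1 f) (hf' : HasCompactSupport f) {v : E} (hv0 : v ≠ 0)
    (hv : ∀ i, inner ℝ (ν i) v ≠ 0) :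
    ∫ x in K, fderiv ℝ f x v =
      ∑ i, σ i * inner ℝ (ν i) v * ∫ x in S i, f x ∂μHE[finrank ℝ E - 1] := by
  have hint := integrable_fderiv_apply hf hf' v
  have hae : (fun x => K.indicator (fun x => fderiv ℝ f x v) x) =ᵐ[volume] fun x =>
      ∑ i, (σ i * (SignType.sign (inner ℝ (ν i) v) : ℝ)) *
        (shadow (ν i) (c i) v (S i)).indicator (fun x => fderiv ℝ f x v) x := by
    have h1 : ∀ i, ∀ᵐ x, hit (ν i) (c i) v x ∈ S i →
        LocalHalfSpace K (ν i) (σ i) (hit (ν i) (c i) v x) := fun i => by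
      have := volume_hit_preimage_null (hν i) (hv i) (fun x hx => hSc i hx.1) (hloc i)
      rw [ae_iff]
      convert this using 2
      ext x
      simp
    have h2 : ∀ i j, ∀ᵐ x, i ≠ j → hit (ν i) (c i) v x ∈ S i → hit (ν i) (c i) v x ∉ S j := by
      intro i j
      by_cases hij : i = j
      · simp [hij]
      have := volume_hit_preimage_null (hν i) (hv i) (fun x hx => hSc i hx.1) (hov i j hij)
      rw [ae_iff]
      convert this using 2
      ext x
      simp [hij]
    -- Off the hyperplanes the hitting time is nonzero, so the endpoint convention is immaterial and
    -- `lineInd` at 0 is the indicator of the shadow.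
    have h3 : ∀ i, ∀ᵐ x : E, inner ℝ (ν i) x ≠ c i := fun i => by
      rw [ae_iff]
      simpa using volume_hyperplane (hν i) (c i)
    filter_upwards [ae_all_iff.2 h1, ae_all_iff.2 fun i => ae_all_iff.2 (h2 i), ae_all_iff.2 h3]
      with x hx1 hx2 hx3
    have key := indicator_line_eq_sum hKb hSc hfr hv0 hv hx1 hx2 0
    rw [zero_smul, add_zero] at key
    have hlin : ∀ i, (shadow (ν i) (c i) v (S i)).indicator (fun x => fderiv ℝ f x v) x =
        lineInd (ν i) (c i) v (S i) (σ i * (SignType.sign (inner ℝ (ν i) v) : ℝ)) x 0 *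
          fderiv ℝ f x v := fun i => by
      have hne : hitTime (ν i) (c i) v x ≠ 0 := by
        rw [hitTime, Ne, div_eq_zero_iff, not_or]
        exact ⟨sub_ne_zero.2 (hx3 i).symm, hv i⟩
      have : x ∈ shadow (ν i) (c i) v (S i) ↔
          hit (ν i) (c i) v x ∈ S i ∧ 0 < hitTime (ν i) (c i) v x := by
        rw [shadow, mem_ofPred_eq, hne.symm.le_iff_lt]
      by_cases h : x ∈ shadow (ν i) (c i) v (S i)
      · simp [h, lineInd, this.1 h]
      · have h' := h
        rw [this] at h'
        simp [h, lineInd, h', hne.symm]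
    have hK1 : K.indicator (fun x => fderiv ℝ f x v) x = K.indicator 1 x * fderiv ℝ f x v := by
      by_cases h : x ∈ K <;> simp [h]
    simp only [hlin]
    rw [hK1, key, Finset.sum_mul]
    simp only [mul_assoc]
  rw [← integral_indicator hK, integral_congr_ae hae, integral_finsetSum]
  · refine Finset.sum_congr rfl fun i _ => ?_
    rw [integral_const_mul, integral_indicator (measurableSet_shadow _ _ _ (hS i).measurableSet),
      integral_shadow (hν i) (hv i) (hS i).measurableSet (hSc i) hf hf', ← mul_assoc]
    congr 1
    rw [mul_assoc, sign_mul_abs]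
  · intro i _
    exact (hint.indicator (measurableSet_shadow _ _ _ (hS i).measurableSet)).const_mul _

/-- Gauss' theorem on a bounded set `K` whose boundary is covered by finitely many flat faces and
that is a half-space near almost every point of the faces. -/
theorem setIntegral_fderiv_eq_sum {K : Set E} (hK : MeasurableSet K)
    (hKb : Bornology.IsBounded K) {S : ι → Set E} (hS : ∀ i, IsClosed (S i))
    {ν : ι → E} (hν : ∀ i, ‖ν i‖ = 1) {c : ι → ℝ}
    (hSc : ∀ i, S i ⊆ {x | inner ℝ (ν i) x = c i}) {σ : ι → ℝ} (hfr : frontier K ⊆ ⋃ i, S i)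
    (hov : ∀ i j, i ≠ j → (μHE[finrank ℝ E - 1] : Measure E) (S i ∩ S j) = 0)
    (hloc : ∀ i, (μHE[finrank ℝ E - 1] : Measure E)
      {x ∈ S i | ¬ LocalHalfSpace K (ν i) (σ i) x} = 0)
    {f : E → ℝ} (hf : ContDiff ℝ 1 f) (hf' : HasCompactSupport f) (v : E) :
    ∫ x in K, fderiv ℝ f x v =
      ∑ i, σ i * inner ℝ (ν i) v * ∫ x in S i, f x ∂μHE[finrank ℝ E - 1] := by
  have hint := fun v => (integrable_fderiv_apply hf hf' v).integrableOn (s := K)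
  let A : E →ₗ[ℝ] ℝ :=
    { toFun := fun v => (∫ x in K, fderiv ℝ f x v) -
        ∑ i, σ i * inner ℝ (ν i) v * ∫ x in S i, f x ∂μHE[finrank ℝ E - 1]
      map_add' := fun v w => by
        simp only [map_add, inner_add_right, mul_add, add_mul, Finset.sum_add_distrib]
        rw [integral_add (hint v) (hint w)]
        ring
      map_smul' := fun r v => by
        simp only [map_smul, inner_smul_right, smul_eq_mul, RingHom.id_apply, mul_sub,
          Finset.mul_sum]
        rw [integral_const_mul]
        congr 1
        refine Finset.sum_congr rfl fun i _ => by ring }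
  suffices h : A = 0 by
    have := LinearMap.congr_fun h v
    exact sub_eq_zero.1 this
  by_contra hA
  -- Both sides are linear in `v`. If they differed, the kernel of the difference `A` and the
  -- hyperplanes orthogonal to the normals would be finitely many proper subspaces, which cannot
  -- cover `E`. A vector outside all of them contradicts the transversal case.
  let s : Option ι → Submodule ℝ E := fun o => o.elim (LinearMap.ker A) fun i =>
    LinearMap.ker (innerSL ℝ (ν i)).toLinearMap
  have hne := Subspace.biUnion_ne_univ_of_top_notMem (k := ℝ) (E := E)
    (s := Finset.univ.image s) ?_
  · obtain ⟨w, hw⟩ := (ne_univ_iff_exists_notMem _).1 hne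
    simp only [Finset.mem_image, Finset.mem_univ, true_and, iUnion_exists, iUnion_iUnion_eq',
      mem_iUnion, not_exists, SetLike.mem_coe] at hw
    have hwA : A w ≠ 0 := hw none
    have hwν : ∀ i, inner ℝ (ν i) w ≠ 0 := fun i => hw (some i)
    have hw0 : w ≠ 0 := by
      rintro rfl
      simp at hwA
    exact hwA (sub_eq_zero.2 (setIntegral_fderiv_eq_sum_of_transversal hK hKb hS hν hSc hfr hov
      hloc hf hf' hw0 hwν))
  · simp only [Finset.mem_image, Finset.mem_univ, true_and, not_exists]
    rintro (_ | i) h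
    · exact hA (LinearMap.ker_eq_top.1 h)
    · have : ν i ∈ s (some i) := h ▸ Submodule.mem_top
      have h2 : inner ℝ (ν i) (ν i) = (0 : ℝ) := this
      rw [inner_self_eq_zero] at h2
      simpa [h2] using hν i

end Gauss


/-! ### One-sided neighbourhoods in convex sets -/

section Local

open Filter Topology

variable {E : Type*} [NormedAddCommGroup E] [InnerProductSpace ℝ E] [FiniteDimensional ℝ E]
  [MeasurableSpace E] [BorelSpace E]

/-- Near `x`, the set `K` contains the half-space with outer normal `σ ν` at `x`. -/
def ContainsHalf (K : Set E) (ν : E) (σ : ℝ) (x : E) : Prop :=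
  ∀ᶠ y in 𝓝 x, σ * inner ℝ ν (y - x) ≤ 0 → y ∈ K

lemma ContainsHalf.mono {K K' : Set E} {ν : E} {σ : ℝ} {x : E} (h : ContainsHalf K ν σ x)
    (hK : K ⊆ K') : ContainsHalf K' ν σ x := by
  filter_upwards [h] with y hy h' using hK (hy h')

/-- The points $x-t\sigma\nu$ with small $t>0$ lie in an open part of the half-space contained in
`A`. -/
lemma ContainsHalf.volume_pos {A : Set E} {ν : E} (hν : ‖ν‖ = 1) {σ : ℝ} (hσ : |σ| = 1) {x : E}
    (h : ContainsHalf A ν σ x) : 0 < volume A := by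
  obtain ⟨U, hU, hUo, hxU⟩ := eventually_nhds_iff.1 h
  have hc : Continuous fun t : ℝ => x - t • (σ • ν) := by fun_prop
  have h1 : ∀ᶠ t : ℝ in 𝓝[>] 0, x - t • (σ • ν) ∈ U :=
    (hc.continuousAt.eventually (hUo.mem_nhds (by simpa using hxU))).filter_mono nhdsWithin_le_nhds
  obtain ⟨t, htU, ht⟩ := (h1.and self_mem_nhdsWithin).exists
  have ht0 : 0 < t := ht
  have hσ2 : σ * σ = 1 := by rw [← abs_mul_abs_self, hσ, one_mul]
  have hopen : IsOpen (U ∩ {y | σ * inner ℝ ν (y - x) < 0}) :=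
    hUo.inter (isOpen_lt (by fun_prop) continuous_const)
  refine (hopen.measure_pos volume ⟨_, htU, ?_⟩).trans_le
    (measure_mono fun y hy => hU y hy.1 (le_of_lt hy.2))
  have : σ * inner ℝ ν (x - t • (σ • ν) - x) = -t := by
    rw [sub_sub_cancel_left, inner_neg_right, inner_smul_right, inner_smul_right,
      real_inner_self_eq_norm_sq, hν]
    linear_combination (-t) * hσ2
  rw [mem_ofPred_eq, this]
  linarith

lemma ContainsHalf.union_mem_nhds {A B : Set E} {ν : E} {x : E} (hA : ContainsHalf A ν 1 x)
    (hB : ContainsHalf B ν (-1) x) : A ∪ B ∈ 𝓝 x := by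
  filter_upwards [hA, hB] with y h1 h2
  rcases le_total (inner ℝ ν (y - x)) 0 with h | h
  · exact Or.inl (h1 (by simpa using h))
  · exact Or.inr (h2 (by simpa using h))

/-- A convex set with interior points contains a half-space near almost every point of its
intersection with a hyperplane. -/
lemma measure_not_containsHalf_of_convex {C : Set E} (hC : Convex ℝ C)
    (hCi : (interior C).Nonempty) {ν : E} (hν : ‖ν‖ = 1) (c : ℝ) :
    (μHE[finrank ℝ E - 1] : Measure E)
      {x | inner ℝ ν x = c ∧ x ∈ C ∧ ¬ ∃ σ : ℝ, |σ| = 1 ∧ ContainsHalf C ν σ x} = 0 := by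
  rw [measure_hyp hν (c := c) fun x hx => hx.1]
  have hconv : Convex ℝ (hyp ν c ⁻¹' C) :=
    (hC.translate_preimage_left (c • ν)).linear_preimage (ℝ ∙ ν)ᗮ.subtype
  -- The slice of `C` is convex in the hyperplane, so its relative boundary is null; only relatively
  -- interior points matter.
  refine measure_mono_null ?_ (hconv.addHaar_frontier volume)
  rintro h ⟨-, hhC, hno⟩
  refine ⟨subset_closure hhC, fun hint => hno ?_⟩
  set x := hyp ν c h with hx
  have hxc : inner ℝ ν x = c := inner_hyp hν c h
  obtain ⟨z, hz, hzc⟩ : ∃ z ∈ interior C, inner ℝ ν z ≠ c := by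
    by_contra! hcon
    exact (isOpen_interior.measure_pos volume hCi).ne'
      (measure_mono_null hcon (volume_hyperplane hν c))
  set δ := inner ℝ ν z - c with hδ
  have hδ0 : δ ≠ 0 := sub_ne_zero.2 hzc
  obtain ⟨U, hU, hUC⟩ : ∃ U ∈ 𝓝 x, hyp ν c ⁻¹' U ⊆ hyp ν c ⁻¹' C := by
    have := mem_interior_iff_mem_nhds.1 hint
    rw [(isometry_hyp ν c).isEmbedding.nhds_eq_comap] at this
    exact mem_comap.1 this
  set t : E → ℝ := fun y => (inner ℝ ν y - c) / δ with ht
  have htc : Continuous t := by fun_prop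
  have htx : t x = 0 := by simp [ht, hxc]
  -- `g y` is the point where the line from the interior point `z` through `y` meets the hyperplane.
  -- For `y` near `x` on the side of `z`, it lies in the slice, and `y` is on the segment between `g
  -- y` and `z`.
  set g : E → E := fun y => (1 - t y)⁻¹ • (y - t y • z) with hg
  have hgc : ContinuousAt g x := by
    refine ContinuousAt.smul (ContinuousAt.inv₀ (by fun_prop) (by simp [htx])) (by fun_prop)
  have hgx : g x = x := by simp [hg, htx]
  -- This sign makes the half-space the one containing `z`.
  refine ⟨-(SignType.sign δ : ℝ), ?_, ?_⟩
  · rcases hδ0.lt_or_gt with h | h <;> simp [h]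
  have e1 : ∀ᶠ y in 𝓝 x, t y < 1 :=
    htc.continuousAt.eventually (Iio_mem_nhds (by rw [htx]; exact one_pos))
  have e2 : ∀ᶠ y in 𝓝 x, g y ∈ U := hgc.eventually (by rwa [hgx])
  filter_upwards [e1, e2] with y h1 h2 h3
  have ht0 : 0 ≤ t y := by
    rw [inner_sub_right, hxc] at h3
    have : t y = |δ|⁻¹ * ((SignType.sign δ : ℝ) * (inner ℝ ν y - c)) := by
      rcases hδ0.lt_or_gt with h | h <;> simp [ht, h, abs_of_neg, abs_of_pos] <;> field_simp
      ring
    rw [this]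
    have : 0 ≤ (SignType.sign δ : ℝ) * (inner ℝ ν y - c) := by linarith
    positivity
  have hne : 1 - t y ≠ 0 := by linarith
  have htδ : t y * δ = inner ℝ ν y - c := div_mul_cancel₀ _ hδ0
  have hgy : inner ℝ ν (g y) = c := by
    simp only [hg, inner_smul_right, inner_sub_right]
    rw [inv_mul_eq_iff_eq_mul₀ hne]
    linear_combination (-1 : ℝ) * htδ - t y * hδ
  have hgC : g y ∈ C := by
    obtain ⟨h', hh'⟩ := (range_hyp hν c).symm ▸ (show g y ∈ {x | inner ℝ ν x = c} from hgy)
    rw [← hh'] at h2 ⊢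
    exact hUC h2
  have hy : y = (1 - t y) • g y + t y • z := by
    simp only [hg, smul_smul, mul_inv_cancel₀ hne]
    module
  rw [hy]
  exact hC hgC (interior_subset hz) (by linarith) ht0 (by ring)

end Local

/-! ### Polytopes and outer normals -/

section Polytope

variable {n : ℕ}

local notation "En" => EuclideanSpace ℝ (Fin n)

lemma IsPolytope.isCompact {K : Set En} (hK : IsPolytope K) : IsCompact K := by
  obtain ⟨s, -, rfl⟩ := hK
  exact s.isCompact_biUnion fun t _ => t.finite_toSet.isCompact_convexHull ℝ

lemma IsPolytope.measure_not_containsHalf {K : Set En} (hK : IsPolytope K) {ν : En}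
    (hν : ‖ν‖ = 1) (c : ℝ) :
    (μHE[n - 1] : Measure En)
      {x | inner ℝ ν x = c ∧ x ∈ K ∧ ¬ ∃ σ : ℝ, |σ| = 1 ∧ ContainsHalf K ν σ x} = 0 := by
  obtain ⟨s, hs, rfl⟩ := hK
  refine measure_mono_null (t := ⋃ t ∈ s, {x | inner ℝ ν x = c ∧ x ∈ convexHull ℝ (t : Set En) ∧
    ¬ ∃ σ : ℝ, |σ| = 1 ∧ ContainsHalf (convexHull ℝ (t : Set En)) ν σ x}) ?_ ?_
  · rintro x ⟨hx, hxK, hno⟩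
    simp only [mem_iUnion] at hxK ⊢
    obtain ⟨t, ht, hxt⟩ := hxK
    exact ⟨t, ht, hx, hxt, fun ⟨σ, hσ, h⟩ => hno ⟨σ, hσ, h.mono (subset_biUnion_of_mem
      (u := fun t : Finset En => convexHull ℝ (t : Set En)) ht)⟩⟩
  · refine (measure_biUnion_null_iff s.countable_toSet).2 fun t ht => ?_
    have := measure_not_containsHalf_of_convex (convex_convexHull ℝ (t : Set En)) (hs t ht) hν c
    rwa [finrank_euclideanSpace_fin] at this

lemma IsPolytope.interior_nonempty {K : Set En} (hK : IsPolytope K) (h : 0 < volume K) :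
    (interior K).Nonempty := by
  obtain ⟨s, hs, rfl⟩ := hK
  obtain ⟨x, hx⟩ := nonempty_of_measure_ne_zero h.ne'
  simp only [mem_iUnion] at hx
  obtain ⟨t, ht, -⟩ := hx
  exact (hs t ht).mono (interior_mono (subset_biUnion_of_mem
      (u := fun t : Finset En => convexHull ℝ (t : Set En)) ht))

lemma HasOuterNormal.containsHalf {K : Set En} {x ν : En} (h : HasOuterNormal K x ν) :
    ContainsHalf K ν 1 x := by
  filter_upwards [h.2] with y hy h'
  exact hy.2 (by simpa using h')

lemma HasOuterNormal.containsHalf_neg {K : Set En} {x ν : En} (h : HasOuterNormal K x (-ν)) :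
    ContainsHalf K ν (-1) x := by
  filter_upwards [h.2] with y hy h'
  exact hy.2 (by simpa using h')

/-- With both normals, a half-space near `x` would be contained in a hyperplane, which is null. -/
lemma HasOuterNormal.not_neg {K : Set En} {x ν : En} (h : HasOuterNormal K x ν) :
    ¬ HasOuterNormal K x (-ν) := by
  intro h'
  have hpos : 0 < volume {y | inner ℝ ν y = inner ℝ ν x} := by
    refine ContainsHalf.volume_pos (ν := ν) (σ := 1) h.1 (by simp) (x := x) ?_
    filter_upwards [h.2, h'.2] with y hy hy' hle
    rw [one_mul] at hle
    have := hy'.1 (hy.2 hle)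
    simp only [inner_neg_left, inner_sub_right] at this hle ⊢
    linarith
  exact hpos.ne' (volume_hyperplane h.1 _)

end Polytope

/-! ### Local geometry of the mesh: faces and their adjacent cells -/

namespace Mesh

open Filter Topology

variable {n : ℕ} {Ω : Set (EuclideanSpace ℝ (Fin n))} (M : Mesh n Ω)

/-- The inclusion of the face is an isometry and hence preserves the Hausdorff measure. -/
lemma measure_face_not_of_ae {S : Fin M.L} {P : EuclideanSpace ℝ (Fin n) → Prop}
    (h : ∀ᵐ x : M.face S ∂μHE[n - 1], P x) :
    (μHE[n - 1] : Measure (EuclideanSpace ℝ (Fin n))) {x ∈ M.face S | ¬ P x} = 0 := by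
  rw [ae_iff, ← isometry_subtype_coe.euclideanHausdorffMeasure_image] at h
  convert h using 2
  ext x
  simp [and_comm]

lemma measure_face_not_outerNormal_plus (S : Fin M.L) :
    (μHE[n - 1] : Measure (EuclideanSpace ℝ (Fin n)))
      {x ∈ M.face S | ¬ HasOuterNormal (M.cell (M.plus S)) x (M.normal S)} = 0 :=
  M.measure_face_not_of_ae (P := fun x => HasOuterNormal (M.cell (M.plus S)) x (M.normal S))
    (M.normal_plus S)

lemma measure_face_not_outerNormal_minus {S : Fin M.L} {K : Fin M.N} (h : M.minus S = some K) :
    (μHE[n - 1] : Measure (EuclideanSpace ℝ (Fin n)))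
      {x ∈ M.face S | ¬ HasOuterNormal (M.cell K) x (-M.normal S)} = 0 :=
  M.measure_face_not_of_ae (P := fun x => HasOuterNormal (M.cell K) x (-M.normal S))
    (M.normal_minus S K h)

lemma isOpen_of_interior_closure (hΩ : interior (closure Ω) = Ω) : IsOpen Ω :=
  hΩ ▸ isOpen_interior

/-- Such a point is interior to $\overline\Omega$, hence lies in the open set
$\Omega=\operatorname{int}\overline\Omega$. -/
lemma notMem_frontier_of_union_mem_nhds (hΩ : interior (closure Ω) = Ω) {K K' : Fin M.N}
    {x : EuclideanSpace ℝ (Fin n)} (h : M.cell K ∪ M.cell K' ∈ 𝓝 x) : x ∉ frontier Ω := by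
  intro hx
  rw [(isOpen_of_interior_closure hΩ).frontier_eq] at hx
  refine hx.2 (hΩ ▸ mem_interior_iff_mem_nhds.2 (mem_of_superset h ?_))
  rw [M.cell_cover]
  exact union_subset (subset_iUnion _ K) (subset_iUnion _ K')

lemma exists_mem_face_of_measure_zero (S : Fin M.L) {B : Set (EuclideanSpace ℝ (Fin n))}
    (hB : (μHE[n - 1] : Measure (EuclideanSpace ℝ (Fin n))) B = 0) : ∃ x ∈ M.face S, x ∉ B := by
  by_contra! h
  exact (M.face_pos S).ne' (measure_mono_null h hB)

/-- A face has positive measure, so at some point the same cell would have both normals $\pm\nu_S$.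
-/
lemma minus_ne_some_plus (S : Fin M.L) : M.minus S ≠ some (M.plus S) := by
  intro h
  obtain ⟨x, hx, hxB⟩ := M.exists_mem_face_of_measure_zero S (measure_union_null
    (M.measure_face_not_outerNormal_plus S)
    (M.measure_face_not_outerNormal_minus h))
  simp only [mem_union, mem_ofPred_eq, hx, true_and, not_or, not_not] at hxB
  exact hxB.1.not_neg hxB.2

/-- Faces in the boundary of `Ω` are not interior faces. -/
lemma minus_eq_none_of_mem_dirichlet (hΩ : interior (closure Ω) = Ω)
    {ΓD : Set (EuclideanSpace ℝ (Fin n))} (hΓD : ΓD ⊆ frontier Ω) {S : Fin M.L}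
    (hS : S ∈ M.dirichlet ΓD) : M.minus S = none := by
  have hS' : M.face S ⊆ ΓD := by simpa [dirichlet] using hS
  by_contra hne
  obtain ⟨K, hK⟩ := Option.ne_none_iff_exists'.1 hne
  obtain ⟨x, hx, hxB⟩ := M.exists_mem_face_of_measure_zero S (measure_union_null
    (M.measure_face_not_outerNormal_plus S)
    (M.measure_face_not_outerNormal_minus hK))
  simp only [mem_union, mem_ofPred_eq, hx, true_and, not_or, not_not] at hxB
  exact M.notMem_frontier_of_union_mem_nhds hΩ
    (hxB.1.containsHalf.union_mem_nhds hxB.2.containsHalf_neg) (hΓD (hS' hx))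

/-- A cell touches the faces of other cells only in null sets. -/
lemma measure_face_inter_cell (hΩ : interior (closure Ω) = Ω) {S : Fin M.L} {K : Fin M.N}
    (hp : M.plus S ≠ K) (hm : M.minus S ≠ some K) :
    (μHE[n - 1] : Measure (EuclideanSpace ℝ (Fin n))) (M.face S ∩ M.cell K) = 0 := by
  obtain ⟨c, hc⟩ := M.face_hyperplane S
  have hν := M.normal_unit S
  have h1 := M.measure_face_not_outerNormal_plus S
  have h2 := (M.cell_polytope K).measure_not_containsHalf hν c
  -- Two different cells cannot contain the same half-space near a point, since their overlap is
  -- null.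
  have hsep : ∀ (K' : Fin M.N) (σ : ℝ) (x), |σ| = 1 → K ≠ K' →
      ContainsHalf (M.cell K) (M.normal S) σ x → ¬ ContainsHalf (M.cell K') (M.normal S) σ x := by
    intro K' σ x hσ hne hK hK'
    refine (ContainsHalf.volume_pos hν hσ (A := M.cell K ∩ M.cell K') (x := x) ?_).ne'
      (M.cell_overlap K K' hne)
    filter_upwards [hK, hK'] with y h h' hy using ⟨h hy, h' hy⟩
  -- The side below the face is taken by $K_+$, so `K` must fill the opposite side. There it
  -- collides with $K_-$ on an interior face; on a boundary face, $K_+\cup K$ would be a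
  -- neighbourhood of a point of $\partial\Omega$.
  have key : ∀ x ∈ M.face S ∩ M.cell K, HasOuterNormal (M.cell (M.plus S)) x (M.normal S) →
      (∃ σ : ℝ, |σ| = 1 ∧ ContainsHalf (M.cell K) (M.normal S) σ x) →
      ContainsHalf (M.cell K) (M.normal S) (-1) x := by
    rintro x - hx ⟨σ, hσ, h⟩
    rcases (abs_eq zero_le_one).1 hσ with rfl | rfl
    · exact absurd hx.containsHalf (hsep _ _ x hσ hp.symm h)
    · exact h
  cases hmS : M.minus S with
  | none =>
    refine measure_mono_null ?_ (measure_union_null h1 h2)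
    intro x hx
    by_contra hxB
    simp only [mem_union, mem_ofPred_eq, hx.1, hx.2, hc x hx.1, true_and, not_or, not_not] at hxB
    exact M.notMem_frontier_of_union_mem_nhds hΩ
      (hxB.1.containsHalf.union_mem_nhds (key x hx hxB.1 hxB.2)) (M.face_boundary S hmS hx.1)
  | some K' =>
    refine measure_mono_null ?_ (measure_union_null (measure_union_null h1 h2)
      (M.measure_face_not_outerNormal_minus hmS))
    intro x hx
    by_contra hxB
    simp only [mem_union, mem_ofPred_eq, hx.1, hx.2, hc x hx.1, true_and, not_or, not_not] at hxB
    exact hsep K' (-1) x (by simp) (fun h => hm (h ▸ hmS)) (key x hx hxB.1.1 hxB.1.2)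
      hxB.2.containsHalf_neg

/-- The sign with which the cell `K` enters the jump along `S`. -/
def sgn (K : Fin M.N) (S : Fin M.L) : ℝ :=
  if M.plus S = K then 1 else if M.minus S = some K then -1 else 0

lemma sum_sgn_mul (S : Fin M.L) (f : Fin M.N → ℝ) : ∑ K, M.sgn K S * f K = M.jump S f := by
  have h : ∀ K, M.sgn K S * f K =
      (if M.plus S = K then f K else 0) - (if M.minus S = some K then f K else 0) := by
    intro K
    by_cases hp : M.plus S = K
    · have : M.minus S ≠ some K := hp ▸ M.minus_ne_some_plus S
      simp [sgn, hp, this]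
    · by_cases hm : M.minus S = some K <;> simp [sgn, hp, hm]
  simp only [h, Finset.sum_sub_distrib, Finset.sum_ite_eq, Finset.mem_univ, if_true]
  cases hm : M.minus S with
  | none => simp [jump, hm]
  | some K => simp [jump, hm]

/-- The local hypothesis of Gauss' theorem: the prescribed normals give the signs $\pm1$, and
`measure_face_inter_cell` gives the sign 0 for all other cells. -/
lemma measure_face_not_localHalfSpace (hΩ : interior (closure Ω) = Ω) (K : Fin M.N)
    (S : Fin M.L) :
    (μHE[n - 1] : Measure (EuclideanSpace ℝ (Fin n)))
      {x ∈ M.face S | ¬ LocalHalfSpace (M.cell K) (M.normal S) (M.sgn K S) x} = 0 := by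
  by_cases hp : M.plus S = K
  · refine measure_mono_null ?_ (M.measure_face_not_outerNormal_plus S)
    refine fun x hx => ⟨hx.1, fun h => hx.2 (Or.inr ⟨by simp [sgn, hp], ?_⟩)⟩
    filter_upwards [h.2] with y hy
    rw [← hp, hy]
    simp [sgn]
  · by_cases hm : M.minus S = some K
    · refine measure_mono_null ?_ (M.measure_face_not_outerNormal_minus hm)
      refine fun x hx => ⟨hx.1, fun h => hx.2 (Or.inr ⟨by simp [sgn, hp, hm], ?_⟩)⟩
      filter_upwards [h.2] with y hy
      rw [hy]
      simp [sgn, hp, hm]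
    · refine measure_mono_null ?_ (M.measure_face_inter_cell hΩ hp hm)
      refine fun x hx => ⟨hx.1, ?_⟩
      by_contra hxK
      exact hx.2 (Or.inl ⟨by simp [sgn, hp, hm],
        fun h => hxK ((M.cell_polytope K).isCompact.isClosed.frontier_subset h)⟩)

/-- Gauss' theorem on a cell of the mesh. -/
theorem setIntegral_cell_fderiv (hΩ : interior (closure Ω) = Ω) (K : Fin M.N)
    {f : EuclideanSpace ℝ (Fin n) → ℝ} (hf : ContDiff ℝ 1 f) (hf' : HasCompactSupport f)
    (v : EuclideanSpace ℝ (Fin n)) :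
    ∫ x in M.cell K, fderiv ℝ f x v = ∑ S, M.sgn K S * inner ℝ (M.normal S) v *
      ∫ x in M.face S, f x ∂μHE[n - 1] := by
  choose c hc using M.face_hyperplane
  have hK := (M.cell_polytope K).isCompact
  have hfin : finrank ℝ (EuclideanSpace ℝ (Fin n)) = n := finrank_euclideanSpace_fin
  have := setIntegral_fderiv_eq_sum hK.measurableSet hK.isBounded M.face_closed M.normal_unit hc
    (σ := M.sgn K) (M.face_cover ▸ subset_iUnion (fun K => frontier (M.cell K)) K)
    (fun S S' h => by rw [hfin]; exact M.face_overlap S S' h)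
    (fun S => by rw [hfin]; exact M.measure_face_not_localHalfSpace hΩ K S) hf hf' v
  rwa [hfin] at this

end Mesh


/-! ### Calculus of polynomial functions -/

section Polynomial

open Filter Topology

variable {n : ℕ}

local notation "En" => EuclideanSpace ℝ (Fin n)

@[simp] lemma ev_add (p q : MvPolynomial (Fin n) ℝ) (x : En) : ev (p + q) x = ev p x + ev q x :=
  map_add _ _ _

@[simp] lemma ev_sub (p q : MvPolynomial (Fin n) ℝ) (x : En) : ev (p - q) x = ev p x - ev q x :=
  map_sub _ _ _

@[simp] lemma ev_mul (p q : MvPolynomial (Fin n) ℝ) (x : En) : ev (p * q) x = ev p x * ev q x :=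
  map_mul _ _ _

@[simp] lemma ev_zero (x : En) : ev (0 : MvPolynomial (Fin n) ℝ) x = 0 := map_zero _

@[simp] lemma ev_smul (r : ℝ) (p : MvPolynomial (Fin n) ℝ) (x : En) :
    ev (r • p) x = r * ev p x := by
  simp [ev, MvPolynomial.smul_eval]

@[simp] lemma ev_sum {ι : Type*} (s : Finset ι) (p : ι → MvPolynomial (Fin n) ℝ) (x : En) :
    ev (∑ i ∈ s, p i) x = ∑ i ∈ s, ev (p i) x :=
  map_sum _ _ _

lemma contDiff_ev (p : MvPolynomial (Fin n) ℝ) : ContDiff ℝ 1 (ev p) := by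
  induction p using MvPolynomial.induction_on with
  | C a =>
    have : (ev (MvPolynomial.C a) : En → ℝ) = fun _ => a := by ext; simp [ev]
    rw [this]
    exact contDiff_const
  | add p q hp hq =>
    have : (ev (p + q) : En → ℝ) = fun x => ev p x + ev q x := by ext; simp
    rw [this]
    exact hp.add hq
  | mul_X p i hp =>
    have hX : ContDiff ℝ 1 fun x : En => x i := by fun_prop
    have : (ev (p * MvPolynomial.X i) : En → ℝ) = fun x => ev p x * x i := by ext; simp [ev]
    rw [this]
    exact hp.mul hX

@[fun_prop]
lemma continuous_ev (p : MvPolynomial (Fin n) ℝ) : Continuous (ev p) := (contDiff_ev p).continuous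

lemma fderiv_ev_single (p : MvPolynomial (Fin n) ℝ) (x : En) (j : Fin n) :
    fderiv ℝ (ev p) x (EuclideanSpace.single j 1) = ev (MvPolynomial.pderiv j p) x := by
  induction p using MvPolynomial.induction_on with
  | C a =>
    have : (ev (MvPolynomial.C a) : En → ℝ) = fun _ => a := by ext; simp [ev]
    simp [this]
  | add p q hp hq =>
    have : (ev (p + q) : En → ℝ) = fun x => ev p x + ev q x := by ext; simp
    rw [this, fderiv_fun_add ((contDiff_ev p).differentiable one_ne_zero x)
      ((contDiff_ev q).differentiable one_ne_zero x)]
    simp [hp, hq]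
  | mul_X p i hp =>
    have : (ev (p * MvPolynomial.X i) : En → ℝ) = fun x => ev p x * x i := by ext; simp [ev]
    have hX : HasFDerivAt (fun x : En => x i) (EuclideanSpace.proj i : En →L[ℝ] ℝ) x :=
      (EuclideanSpace.proj i : En →L[ℝ] ℝ).hasFDerivAt
    rw [this, (((contDiff_ev p).differentiable one_ne_zero x).hasFDerivAt.fun_mul hX).fderiv]
    by_cases h : j = i
    · subst h
      simp [hp]
      simp [ev]
    · have h' : i ≠ j := Ne.symm h
      simp [MvPolynomial.pderiv_X_of_ne h', hp, h']
      simp [ev]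

/-- A polynomial vanishing on a nonempty open set is zero. -/
lemma eq_zero_of_ev_eq_zero {p : MvPolynomial (Fin n) ℝ} {U : Set En} (hU : IsOpen U)
    (hne : U.Nonempty) (h : ∀ x ∈ U, ev p x = 0) : p = 0 := by
  obtain ⟨x, hx⟩ := hne
  have hc : Continuous fun y : Fin n → ℝ => (WithLp.toLp 2 y : En) := by fun_prop
  obtain ⟨ε, hε, hball⟩ := Metric.isOpen_iff.1 (hU.preimage hc) (WithLp.ofLp x) (by simpa using hx)
  -- A ball for the supremum norm is a product of infinite sets of reals.
  refine MvPolynomial.funext_set (fun i => Metric.ball (x i) ε) (fun i => ?_) fun y hy => ?_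
  · exact infinite_of_mem_nhds _ (Metric.ball_mem_nhds _ hε)
  · rw [← ball_pi _ hε] at hy
    simpa [ev] using h _ (hball hy)

lemma totalDegree_pderiv_le {p : MvPolynomial (Fin n) ℝ} {k : ℕ} (hp : p.totalDegree ≤ k + 1)
    (i : Fin n) : (MvPolynomial.pderiv i p).totalDegree ≤ k := by
  refine Finset.sup_le fun m hm => ?_
  rw [MvPolynomial.mem_support_iff, MvPolynomial.coeff_pderiv] at hm
  have h := MvPolynomial.le_totalDegree (MvPolynomial.mem_support_iff.2 (left_ne_zero_of_mul hm))
  rw [Finsupp.sum_add_index' (by simp) (by simp), Finsupp.sum_single_index rfl] at h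
  omega

/-- The coefficient of $\partial_ip$ at $m-e_i$ is $m_i$ times that of $p$ at $m$, and $m_i\neq0$ in
characteristic zero. -/
lemma totalDegree_eq_zero_of_pderiv {p : MvPolynomial (Fin n) ℝ}
    (hp : ∀ i, MvPolynomial.pderiv i p = 0) : p.totalDegree = 0 := by
  rw [MvPolynomial.totalDegree_eq_zero_iff]
  intro m hm i
  by_contra hi
  have h := congrArg (MvPolynomial.coeff (m - Finsupp.single i 1)) (hp i)
  have hle : Finsupp.single i 1 ≤ m := Finsupp.single_le_iff.2 (Nat.one_le_iff_ne_zero.2 hi)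
  rw [MvPolynomial.coeff_pderiv, tsub_add_cancel_of_le hle, MvPolynomial.coeff_zero,
    mul_eq_zero] at h
  rcases h with h | h
  · exact MvPolynomial.mem_support_iff.1 hm h
  · exact absurd h (by norm_cast)

end Polynomial

/-! ### Piecewise integration by parts -/

namespace Mesh

open Filter Topology

variable {n : ℕ} {Ω : Set (EuclideanSpace ℝ (Fin n))} (M : Mesh n Ω)

lemma isCompact_cell (K : Fin M.N) : IsCompact (M.cell K) := (M.cell_polytope K).isCompact

lemma isCompact_face (S : Fin M.L) : IsCompact (M.face S) :=
  (M.isCompact_cell (M.plus S)).of_isClosed_subset (M.face_closed S) (M.face_plus S)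

instance (S : Fin M.L) : CompactSpace (M.face S) :=
  isCompact_iff_compactSpace.1 (M.isCompact_face S)

/-- A face is a bounded part of a hyperplane, where the measure is Lebesgue measure. -/
instance (S : Fin M.L) : IsFiniteMeasure (μHE[n - 1] : Measure (M.face S)) := by
  refine ⟨?_⟩
  rw [← isometry_subtype_coe.euclideanHausdorffMeasure_image, image_univ, Subtype.range_coe]
  obtain ⟨c, hc⟩ := M.face_hyperplane S
  have := measure_hyperplane_lt_top (M.normal_unit S) (c := c) hc (M.isCompact_face S).isBounded
  rwa [finrank_euclideanSpace_fin] at this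

lemma integrable_face {S : Fin M.L} {f : M.face S → ℝ} (hf : Continuous f) :
    Integrable f μHE[n - 1] :=
  hf.integrable_of_hasCompactSupport (HasCompactSupport.of_compactSpace f)

lemma integral_face (S : Fin M.L) (f : EuclideanSpace ℝ (Fin n) → ℝ) :
    ∫ x : M.face S, f x ∂μHE[n - 1] = ∫ x in M.face S, f x ∂μHE[n - 1] := by
  rw [← (MeasurableEmbedding.subtype_coe (M.face_closed S).measurableSet).integral_map,
    isometry_subtype_coe.map_euclideanHausdorffMeasure, Subtype.range_coe]

lemma integrableOn_cell (K : Fin M.N) {f : EuclideanSpace ℝ (Fin n) → ℝ} (hf : Continuous f) :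
    IntegrableOn f (M.cell K) :=
  hf.continuousOn.integrableOn_compact (M.isCompact_cell K)

/-- Gauss' theorem for a polynomial on a cell. -/
theorem setIntegral_cell_pderiv (hΩ : interior (closure Ω) = Ω) (K : Fin M.N)
    (p : MvPolynomial (Fin n) ℝ) (j : Fin n) :
    ∫ x in M.cell K, ev (MvPolynomial.pderiv j p) x =
      ∑ S, M.sgn K S * M.normal S j * ∫ x : M.face S, ev p x ∂μHE[n - 1] := by
  have hb : Bornology.IsBounded (⋃ K, M.cell K) :=
    (isCompact_iUnion M.isCompact_cell).isBounded
  obtain ⟨R, hR0, hR⟩ := hb.subset_ball_lt 0 0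
  -- A cutoff equal to 1 near all cells makes the polynomial compactly supported without changing
  -- any of the integrals.
  let χ : ContDiffBump (0 : EuclideanSpace ℝ (Fin n)) := ⟨R, R + 1, hR0, by linarith⟩
  have hχ : ∀ K, ∀ x ∈ M.cell K, χ =ᶠ[𝓝 x] 1 := fun K x hx =>
    χ.eventuallyEq_one_of_mem_ball (hR (mem_iUnion_of_mem K hx))
  have hg := M.setIntegral_cell_fderiv hΩ K (f := fun x => χ x * ev p x)
    (χ.contDiff.mul (contDiff_ev p)) χ.hasCompactSupport.mul_right (EuclideanSpace.single j 1)
  have h1 : ∀ x ∈ M.cell K, fderiv ℝ (fun x => χ x * ev p x) x (EuclideanSpace.single j 1) =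
      ev (MvPolynomial.pderiv j p) x := fun x hx => by
    have : (fun x => χ x * ev p x) =ᶠ[𝓝 x] ev p := by
      filter_upwards [hχ K x hx] with y hy
      simp [hy]
    rw [this.fderiv_eq, fderiv_ev_single]
  rw [setIntegral_congr_fun (M.isCompact_cell K).measurableSet h1] at hg
  rw [hg]
  refine Finset.sum_congr rfl fun S _ => ?_
  rw [integral_face, setIntegral_congr_fun (M.face_closed S).measurableSet
    fun x hx => show χ x * ev p x = ev p x by
      rw [(hχ _ x (M.face_plus S hx)).self_of_nhds]; simp]
  simp [EuclideanSpace.inner_single_right]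

/-- Piecewise integration by parts. -/
theorem l2_pwGrad_add_l2_pwDiv (hΩ : interior (closure Ω) = Ω) {m : ℕ} (u : M.PwField (Fin m))
    (τ : M.PwField (Fin m × Fin n)) :
    M.l2 (M.pwGrad u) τ + M.l2 u (M.pwDiv τ) = ∑ S, ∫ x : M.face S,
      ∑ i, M.jump S (fun K => ev (u K i) x * ∑ j, ev (τ K (i, j)) x * M.normal S j)
        ∂μHE[n - 1] := by
  have hcell : ∀ K, (∫ x in M.cell K, ∑ ij, ev (M.pwGrad u K ij) x * ev (τ K ij) x) +
      (∫ x in M.cell K, ∑ i, ev (u K i) x * ev (M.pwDiv τ K i) x) =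
      ∑ i, ∑ j, ∑ S, M.sgn K S * M.normal S j *
        ∫ x : M.face S, ev (u K i * τ K (i, j)) x ∂μHE[n - 1] := by
    intro K
    rw [← integral_add (M.integrableOn_cell K (by fun_prop)) (M.integrableOn_cell K (by fun_prop))]
    -- Gauss' theorem, read backwards, for the products $u_i\tau_{ij}$; the product rule then
    -- matches the integrands.
    simp only [← M.setIntegral_cell_pderiv hΩ]
    simp_rw [← integral_finsetSum Finset.univ fun j _ => M.integrableOn_cell K
      (continuous_ev (MvPolynomial.pderiv j (u K _ * τ K (_, j))))]
    rw [← integral_finsetSum Finset.univ fun i _ => M.integrableOn_cell K (by fun_prop)]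
    congr 1
    ext x
    simp only [Fintype.sum_prod_type, ← Finset.sum_add_distrib, pwGrad, pwDiv, ev_sum,
      Finset.mul_sum, MvPolynomial.pderiv_mul, ev_add, ev_mul]
  have hface : ∀ S, (∫ x : M.face S, ∑ i, M.jump S (fun K => ev (u K i) x *
        ∑ j, ev (τ K (i, j)) x * M.normal S j) ∂μHE[n - 1]) =
      ∑ K, ∑ i, ∑ j, M.sgn K S * M.normal S j *
        ∫ x : M.face S, ev (u K i * τ K (i, j)) x ∂μHE[n - 1] := by
    intro S
    simp only [← integral_const_mul]
    have hc : ∀ K i j, Continuous fun x : M.face S =>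
        M.sgn K S * M.normal S j * ev (u K i * τ K (i, j)) x := fun K i j => by fun_prop
    simp_rw [← integral_finsetSum Finset.univ fun j _ => M.integrable_face (hc _ _ j)]
    simp_rw [← integral_finsetSum Finset.univ fun i _ => M.integrable_face
      (continuous_finsetSum Finset.univ fun j _ => hc _ i j)]
    rw [← integral_finsetSum Finset.univ fun K _ => M.integrable_face
      (continuous_finsetSum Finset.univ fun i _ =>
        continuous_finsetSum Finset.univ fun j _ => hc K i j)]
    congr 1
    ext x
    simp only [← sum_sgn_mul]
    rw [Finset.sum_comm]
    refine Finset.sum_congr rfl fun K _ => Finset.sum_congr rfl fun i _ => ?_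
    simp only [Finset.mul_sum, ev_mul]
    refine Finset.sum_congr rfl fun j _ => by ring
  simp only [l2, ← Finset.sum_add_distrib, hcell, hface]
  conv_rhs => rw [Finset.sum_comm]
  refine Finset.sum_congr rfl fun K _ => ?_
  conv_rhs => rw [Finset.sum_comm]
  refine Finset.sum_congr rfl fun i _ => ?_
  rw [Finset.sum_comm]

end Mesh


/-! ### Representation of functionals and the $L^2$ product of piecewise polynomials -/

/-- A linear functional that vanishes on the isotropic vectors of a symmetric bilinear form on a
finite-dimensional space is represented by the form. -/
lemma exists_bilin_eq {X : Type*} [AddCommGroup X] [Module ℝ X] (W : Submodule ℝ X)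
    [FiniteDimensional ℝ W] (B : X →ₗ[ℝ] X →ₗ[ℝ] ℝ) (hB : ∀ x y, B x y = B y x) (ℓ : X →ₗ[ℝ] ℝ)
    (h : ∀ x ∈ W, B x x = 0 → ℓ x = 0) : ∃ u ∈ W, ∀ w ∈ W, B u w = ℓ w := by
  let b : W →ₗ[ℝ] Dual ℝ W := B.domRestrict₁₂ W W
  -- Vectors in the radical of the form are isotropic, so the functional annihilates the kernel of
  -- `b` and therefore lies in the range of the transpose. By finite dimension its preimage is
  -- evaluation at some `u`.
  have hmem : ℓ.domRestrict W ∈ (LinearMap.ker b).dualAnnihilator := by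
    rw [Submodule.mem_dualAnnihilator]
    intro x hx
    exact h x x.2 (LinearMap.congr_fun (LinearMap.mem_ker.1 hx) x)
  rw [← LinearMap.range_dualMap_eq_dualAnnihilator_ker] at hmem
  obtain ⟨φ, hφ⟩ := hmem
  obtain ⟨u, rfl⟩ := (Module.evalEquiv ℝ W).surjective φ
  refine ⟨u, u.2, fun w hw => ?_⟩
  have := LinearMap.congr_fun hφ ⟨w, hw⟩
  rw [hB]
  exact this

namespace Mesh

variable {n : ℕ} {Ω : Set (EuclideanSpace ℝ (Fin n))} (M : Mesh n Ω)

section L2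

variable {ι : Type} [Fintype ι]

lemma l2_comm (u w : M.PwField ι) : M.l2 u w = M.l2 w u := by
  simp only [l2, mul_comm]

lemma l2_add_left (u u' w : M.PwField ι) : M.l2 (u + u') w = M.l2 u w + M.l2 u' w := by
  rw [l2, l2, l2, ← Finset.sum_add_distrib]
  refine Finset.sum_congr rfl fun K _ => ?_
  rw [← integral_add (M.integrableOn_cell K (by fun_prop)) (M.integrableOn_cell K (by fun_prop))]
  simp [add_mul, Finset.sum_add_distrib]

lemma l2_smul_left (r : ℝ) (u w : M.PwField ι) : M.l2 (r • u) w = r * M.l2 u w := by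
  rw [l2, l2, Finset.mul_sum]
  refine Finset.sum_congr rfl fun K _ => ?_
  rw [← integral_const_mul]
  simp [Finset.mul_sum, mul_assoc]

/-- The `L²` scalar product as a bilinear form. -/
def l2L (ι : Type) [Fintype ι] : M.PwField ι →ₗ[ℝ] M.PwField ι →ₗ[ℝ] ℝ :=
  LinearMap.mk₂ ℝ M.l2 M.l2_add_left M.l2_smul_left
    (fun u w w' => by simp only [M.l2_comm u, M.l2_add_left])
    (fun r u w => by simp only [M.l2_comm u, M.l2_smul_left, smul_eq_mul])

@[simp] lemma l2L_apply (u w : M.PwField ι) : M.l2L ι u w = M.l2 u w := rfl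

lemma l2_zero_left (w : M.PwField ι) : M.l2 0 w = 0 := by
  rw [← l2L_apply, map_zero, LinearMap.zero_apply]

/-- The integrand is continuous and nonnegative, so it vanishes on the nonempty interior of each
cell, which forces the polynomials to be zero. -/
lemma eq_zero_of_l2_self {u : M.PwField ι} (h : M.l2 u u = 0) : u = 0 := by
  have hnn : ∀ K, 0 ≤ ∫ x in M.cell K, ∑ i, ev (u K i) x * ev (u K i) x := fun K =>
    integral_nonneg fun x => Finset.sum_nonneg fun i _ => mul_self_nonneg _
  have h0 := (Finset.sum_eq_zero_iff_of_nonneg fun K _ => hnn K).1 h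
  ext1 K
  ext1 i
  have hne := (M.cell_polytope K).interior_nonempty (M.cell_pos K)
  refine eq_zero_of_ev_eq_zero isOpen_interior hne ?_
  have hc : Continuous fun x => ∑ i, ev (u K i) x * ev (u K i) x := by fun_prop
  have hae := (integral_eq_zero_iff_of_nonneg
    (fun x => Finset.sum_nonneg fun i _ => mul_self_nonneg _)
    (M.integrableOn_cell K hc)).1 (h0 K (Finset.mem_univ K))
  have hae' := ae_restrict_of_ae_restrict_of_subset (interior_subset (s := M.cell K)) hae
  have heq := Measure.eqOn_open_of_ae_eq hae' isOpen_interior hc.continuousOn continuousOn_const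
  intro x hx
  have := (Finset.sum_eq_zero_iff_of_nonneg fun i _ => mul_self_nonneg _).1 (heq hx) i
    (Finset.mem_univ i)
  exact mul_self_eq_zero.1 this

/-- The space `P_k(M)` as a subspace. -/
def cellSub (k : ℕ) (ι : Type) : Submodule ℝ (M.PwField ι) :=
  LinearMap.range (LinearMap.pi fun K => LinearMap.pi fun i =>
    (MvPolynomial.restrictTotalDegree (Fin n) ℝ k).subtype ∘ₗ LinearMap.proj i ∘ₗ
      LinearMap.proj (φ := fun _ : Fin M.N => ι → MvPolynomial.restrictTotalDegree (Fin n) ℝ k) K)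

/-- Unfolded, the space is the range of a linear map on a finite product of finite-dimensional
spaces. -/
instance (k : ℕ) (ι : Type) [Finite ι] : FiniteDimensional ℝ (M.cellSub k ι) := by
  unfold cellSub
  infer_instance

lemma mem_cellSub {k : ℕ} {ι : Type} {u : M.PwField ι} :
    u ∈ M.cellSub k ι ↔ u ∈ M.cellP k ι := by
  constructor
  · rintro ⟨v, rfl⟩ K i
    exact (MvPolynomial.mem_restrictTotalDegree _ _ _).1 (v K i).2
  · intro h
    exact ⟨fun K i => ⟨u K i, (MvPolynomial.mem_restrictTotalDegree _ _ _).2 (h K i)⟩, rfl⟩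

lemma exists_l2_eq (W : Submodule ℝ (M.PwField ι)) [FiniteDimensional ℝ W]
    (ℓ : M.PwField ι →ₗ[ℝ] ℝ) : ∃ u ∈ W, ∀ w ∈ W, M.l2 u w = ℓ w :=
  exists_bilin_eq W (M.l2L ι) M.l2_comm ℓ fun x _ hx => by
    rw [M.eq_zero_of_l2_self hx, map_zero]

end L2

/-! ### Traces and projections on faces -/

section Face

variable {ι : Type} [Fintype ι]

lemma intFace_eq_sum (S : Fin M.L) {f g : ι → M.face S → ℝ} (hf : ∀ i, Continuous (f i))
    (hg : ∀ i, Continuous (g i)) :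
    M.intFace S f g = ∑ i, ∫ x, f i x * g i x ∂μHE[n - 1] :=
  integral_finsetSum _ fun i _ => M.integrable_face ((hf i).mul (hg i))

lemma intFace_comm (S : Fin M.L) (f g : ι → M.face S → ℝ) :
    M.intFace S f g = M.intFace S g f := by
  simp only [intFace, mul_comm]

lemma intFace_add_left (S : Fin M.L) {f f' g : ι → M.face S → ℝ} (hf : ∀ i, Continuous (f i))
    (hf' : ∀ i, Continuous (f' i)) (hg : ∀ i, Continuous (g i)) :
    M.intFace S (f + f') g = M.intFace S f g + M.intFace S f' g := by
  rw [intFace, intFace, intFace, ← integral_add (M.integrable_face (by fun_prop))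
    (M.integrable_face (by fun_prop))]
  simp [add_mul, Finset.sum_add_distrib]

lemma intFace_sub_left (S : Fin M.L) {f f' g : ι → M.face S → ℝ} (hf : ∀ i, Continuous (f i))
    (hf' : ∀ i, Continuous (f' i)) (hg : ∀ i, Continuous (g i)) :
    M.intFace S (f - f') g = M.intFace S f g - M.intFace S f' g := by
  rw [intFace, intFace, intFace, ← integral_sub (M.integrable_face (by fun_prop))
    (M.integrable_face (by fun_prop))]
  simp [sub_mul, Finset.sum_sub_distrib]

lemma intFace_smul_left (S : Fin M.L) (r : ℝ) (f g : ι → M.face S → ℝ) :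
    M.intFace S (r • f) g = r * M.intFace S f g := by
  rw [intFace, intFace, ← integral_const_mul]
  simp [Finset.mul_sum, mul_assoc]

lemma intFace_zero_left (S : Fin M.L) {f g : ι → M.face S → ℝ} (hf : ∀ i x, f i x = 0) :
    M.intFace S f g = 0 := by
  simp [intFace, hf]

/-- The functional `w ↦ ∑_S ∫_S f_S ⬝ A_S w` for a family of linear trace operators `A_S`. -/
def faceFunctional {X : Type*} [AddCommGroup X] [Module ℝ X] (f : M.FaceField ι)
    (hf : ∀ S i, Continuous (f S i)) (A : X → M.FaceField ι)
    (hA : ∀ w S i, Continuous (A w S i)) (hadd : ∀ w w', A (w + w') = A w + A w')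
    (hsmul : ∀ (r : ℝ) w, A (r • w) = r • A w) : X →ₗ[ℝ] ℝ where
  toFun w := ∑ S, M.intFace S (A w S) (f S)
  map_add' w w' := by
    rw [← Finset.sum_add_distrib]
    refine Finset.sum_congr rfl fun S _ => ?_
    rw [hadd, Pi.add_apply, M.intFace_add_left S (hA w S) (hA w' S) (hf S)]
  map_smul' r w := by
    rw [RingHom.id_apply, smul_eq_mul, Finset.mul_sum]
    refine Finset.sum_congr rfl fun S _ => ?_
    rw [hsmul, Pi.smul_apply, M.intFace_smul_left]

lemma continuous_of_mem_polyOn {k : ℕ} {A : Set (EuclideanSpace ℝ (Fin n))} {f : A → ℝ}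
    (hf : f ∈ PolyOn k A) : Continuous f := by
  obtain ⟨p, -, hp⟩ := hf
  rw [show f = fun x : A => ev p x from funext hp]
  fun_prop

/-- The jump of a cell-wise polynomial. -/
lemma jump_mem_polyOn {k : ℕ} {S : Fin M.L} {u : Fin M.N → MvPolynomial (Fin n) ℝ}
    (hu : ∀ K, (u K).totalDegree ≤ k) :
    (fun x : M.face S => M.jump S fun K => ev (u K) x) ∈ PolyOn k (M.face S) := by
  cases hm : M.minus S with
  | none => exact ⟨u (M.plus S), hu _, fun x => by simp [jump, hm]⟩
  | some K =>
    exact ⟨u (M.plus S) - u K, (MvPolynomial.totalDegree_sub _ _).trans (max_le (hu _) (hu _)),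
      fun x => by simp [jump, hm]⟩

lemma avg_mem_polyOn {k : ℕ} {S : Fin M.L} {u : Fin M.N → MvPolynomial (Fin n) ℝ}
    (hu : ∀ K, (u K).totalDegree ≤ k) :
    (fun x : M.face S => M.avg S fun K => ev (u K) x) ∈ PolyOn k (M.face S) := by
  cases hm : M.minus S with
  | none => exact ⟨u (M.plus S), hu _, fun x => by simp [avg, hm]⟩
  | some K =>
    refine ⟨(1 / 2 : ℝ) • (u (M.plus S) + u K), (MvPolynomial.totalDegree_smul_le _ _).trans
      ((MvPolynomial.totalDegree_add _ _).trans (max_le (hu _) (hu _))), fun x => ?_⟩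
    simp [avg, hm]
    ring

lemma jumpTr_mem_polyOn {k : ℕ} {v : M.PwField ι} (hv : v ∈ M.cellP k ι) (S : Fin M.L) (i : ι) :
    M.jumpTr v S i ∈ PolyOn k (M.face S) :=
  M.jump_mem_polyOn fun K => hv K i

lemma avgTr_mem_polyOn {k : ℕ} {v : M.PwField ι} (hv : v ∈ M.cellP k ι) (S : Fin M.L) (i : ι) :
    M.avgTr v S i ∈ PolyOn k (M.face S) :=
  M.avg_mem_polyOn fun K => hv K i

/-- The polynomial `(τ ν_S)_i` on the cell `K`. -/
def normalComp {m : ℕ} (τ : M.PwField (Fin m × Fin n)) (S : Fin M.L) (i : Fin m) (K : Fin M.N) :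
    MvPolynomial (Fin n) ℝ :=
  ∑ j, M.normal S j • τ K (i, j)

lemma ev_normalComp {m : ℕ} (τ : M.PwField (Fin m × Fin n)) (S : Fin M.L) (i : Fin m)
    (K : Fin M.N) (x : EuclideanSpace ℝ (Fin n)) :
    ev (M.normalComp τ S i K) x = ∑ j, ev (τ K (i, j)) x * M.normal S j := by
  simp [normalComp, mul_comm]

lemma totalDegree_normalComp {k m : ℕ} {τ : M.PwField (Fin m × Fin n)}
    (hτ : τ ∈ M.cellP k (Fin m × Fin n)) (S : Fin M.L) (i : Fin m) (K : Fin M.N) :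
    (M.normalComp τ S i K).totalDegree ≤ k :=
  MvPolynomial.totalDegree_finsetSum_le fun j _ =>
    (MvPolynomial.totalDegree_smul_le _ _).trans (hτ K (i, j))

lemma jumpNormal_mem_polyOn {k m : ℕ} {τ : M.PwField (Fin m × Fin n)}
    (hτ : τ ∈ M.cellP k (Fin m × Fin n)) (S : Fin M.L) (i : Fin m) :
    M.jumpNormal τ S i ∈ PolyOn k (M.face S) := by
  have := M.jump_mem_polyOn (S := S) (M.totalDegree_normalComp hτ S i)
  simp only [ev_normalComp] at this
  exact this

lemma avgNormal_mem_polyOn {k m : ℕ} {τ : M.PwField (Fin m × Fin n)}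
    (hτ : τ ∈ M.cellP k (Fin m × Fin n)) (S : Fin M.L) (i : Fin m) :
    M.avgNormal τ S i ∈ PolyOn k (M.face S) := by
  have := M.avg_mem_polyOn (S := S) (M.totalDegree_normalComp hτ S i)
  simp only [ev_normalComp] at this
  exact this

/-- Provides some degree bound, so that continuity of traces follows from their being polynomial. -/
lemma exists_mem_cellP (u : M.PwField ι) : ∃ k, u ∈ M.cellP k ι := by
  refine ⟨∑ K, ∑ i, (u K i).totalDegree, fun K i => ?_⟩
  exact (Finset.single_le_sum (f := fun i => (u K i).totalDegree) (fun _ _ => Nat.zero_le _)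
    (Finset.mem_univ i)).trans (Finset.single_le_sum
    (f := fun K => ∑ i, (u K i).totalDegree) (fun _ _ => Nat.zero_le _) (Finset.mem_univ K))

lemma continuous_jumpTr (v : M.PwField ι) (S : Fin M.L) (i : ι) : Continuous (M.jumpTr v S i) :=
  have ⟨_, h⟩ := M.exists_mem_cellP v
  continuous_of_mem_polyOn (M.jumpTr_mem_polyOn h S i)

lemma continuous_jumpNormal {m : ℕ} (τ : M.PwField (Fin m × Fin n)) (S : Fin M.L) (i : Fin m) :
    Continuous (M.jumpNormal τ S i) :=
  have ⟨_, h⟩ := M.exists_mem_cellP τ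
  continuous_of_mem_polyOn (M.jumpNormal_mem_polyOn h S i)

lemma jump_add (S : Fin M.L) (f g : Fin M.N → ℝ) :
    M.jump S (fun K => f K + g K) = M.jump S f + M.jump S g := by
  simp only [← sum_sgn_mul, mul_add, Finset.sum_add_distrib]

lemma jump_smul (S : Fin M.L) (r : ℝ) (f : Fin M.N → ℝ) :
    M.jump S (fun K => r * f K) = r * M.jump S f := by
  simp only [← sum_sgn_mul, Finset.mul_sum]
  exact Finset.sum_congr rfl fun K _ => by ring

lemma jumpTr_add (v w : M.PwField ι) : M.jumpTr (v + w) = M.jumpTr v + M.jumpTr w := by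
  ext S i x
  simp [jumpTr, jump_add]

lemma jumpTr_smul (r : ℝ) (v : M.PwField ι) : M.jumpTr (r • v) = r • M.jumpTr v := by
  ext S i x
  simp [jumpTr, jump_smul]

lemma jumpNormal_add {m : ℕ} (v w : M.PwField (Fin m × Fin n)) :
    M.jumpNormal (v + w) = M.jumpNormal v + M.jumpNormal w := by
  ext S i x
  simp [jumpNormal, ← jump_add, add_mul, Finset.sum_add_distrib]

lemma jumpNormal_smul {m : ℕ} (r : ℝ) (v : M.PwField (Fin m × Fin n)) :
    M.jumpNormal (r • v) = r • M.jumpNormal v := by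
  ext S i x
  simp [jumpNormal, ← jump_smul, mul_assoc, Finset.mul_sum]

/-- On polynomials in $n$ variables the $L^2(S)$ form is only semidefinite, since nonzero
polynomials may vanish on the hyperplane of `S`. Isotropic ones vanish almost everywhere on `S` and
are thus also orthogonal to `p`, which is what `exists_bilin_eq` requires. -/
lemma exists_isFaceProj (k : ℕ) (S : Fin M.L) (p : MvPolynomial (Fin n) ℝ) :
    ∃ q, M.IsFaceProj k S (fun x => ev p x) q := by
  have hi : ∀ p q : MvPolynomial (Fin n) ℝ,
      Integrable (fun x : M.face S => ev p x * ev q x) μHE[n - 1] := fun p q =>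
    M.integrable_face (by fun_prop)
  let B : MvPolynomial (Fin n) ℝ →ₗ[ℝ] MvPolynomial (Fin n) ℝ →ₗ[ℝ] ℝ :=
    LinearMap.mk₂ ℝ (fun p q => ∫ x : M.face S, ev p x * ev q x ∂μHE[n - 1])
      (fun p p' q => by rw [← integral_add (hi _ _) (hi _ _)]; simp [add_mul])
      (fun r p q => by rw [smul_eq_mul, ← integral_const_mul]; simp [mul_assoc])
      (fun p q q' => by rw [← integral_add (hi _ _) (hi _ _)]; simp [mul_add])
      (fun r p q => by rw [smul_eq_mul, ← integral_const_mul]; simp [mul_left_comm])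
  obtain ⟨q, hq, h⟩ := exists_bilin_eq (MvPolynomial.restrictTotalDegree (Fin n) ℝ k) B
    (fun p q => by simp only [B, LinearMap.mk₂_apply, mul_comm]) (B p) fun r _ hr => by
      have hae := (integral_eq_zero_iff_of_nonneg (fun x : M.face S => mul_self_nonneg (ev r x))
        (hi r r)).1 hr
      refine integral_eq_zero_of_ae ?_
      filter_upwards [hae] with x hx
      have : ev r (x : EuclideanSpace ℝ (Fin n)) = 0 := mul_self_eq_zero.1 hx
      simp [this]
  refine ⟨fun x => ev q x, ⟨q, (MvPolynomial.mem_restrictTotalDegree _ _ _).1 hq, fun x => rfl⟩, ?_⟩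
  rintro r ⟨r', hr', hr⟩
  simp only [hr]
  exact h r' ((MvPolynomial.mem_restrictTotalDegree _ _ _).2 hr')

lemma isFaceProj_faceProj (k : ℕ) {l : ℕ} {S : Fin M.L} {f : ι → M.face S → ℝ}
    (hf : ∀ i, f i ∈ PolyOn l (M.face S)) (i : ι) :
    M.IsFaceProj k S (f i) (M.faceProj k S f i) := by
  obtain ⟨p, -, hp⟩ := hf i
  have h := M.exists_isFaceProj k S p
  rw [← (funext hp : f i = fun x : M.face S => ev p x)] at h
  exact Classical.epsilon_spec h

lemma intFace_faceProj {k l : ℕ} {S : Fin M.L} {f g : ι → M.face S → ℝ}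
    (hf : ∀ i, f i ∈ PolyOn l (M.face S)) (hg : ∀ i, g i ∈ PolyOn k (M.face S)) :
    M.intFace S (M.faceProj k S f) g = M.intFace S f g := by
  have hp := M.isFaceProj_faceProj k hf
  rw [M.intFace_eq_sum S (fun i => continuous_of_mem_polyOn (hp i).1)
      (fun i => continuous_of_mem_polyOn (hg i)),
    M.intFace_eq_sum S (fun i => continuous_of_mem_polyOn (hf i))
      (fun i => continuous_of_mem_polyOn (hg i))]
  exact Finset.sum_congr rfl fun i _ => (hp i).2 _ (hg i)

end Face

/-! ### Existence of the reconstructions -/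

section Reconstruction

variable {m : ℕ}

/-- The piecewise gradient as a linear map. -/
def pwGradL (m : ℕ) : M.PwField (Fin m) →ₗ[ℝ] M.PwField (Fin m × Fin n) where
  toFun := M.pwGrad
  map_add' u v := by ext1 K; ext1 ij; simp [pwGrad]
  map_smul' r v := by ext1 K; ext1 ij; simp [pwGrad]

/-- The piecewise divergence as a linear map. -/
def pwDivL (m : ℕ) : M.PwField (Fin m × Fin n) →ₗ[ℝ] M.PwField (Fin m) where
  toFun := M.pwDiv
  map_add' u v := by ext1 K; ext1 i; simp [pwDiv, Finset.sum_add_distrib]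
  map_smul' r v := by ext1 K; ext1 i; simp [pwDiv, Finset.smul_sum]

lemma pwGrad_mem_cellP {k : ℕ} {u : M.PwField (Fin m)} (hu : u ∈ M.cellP (k + 1) (Fin m)) :
    M.pwGrad u ∈ M.cellP k (Fin m × Fin n) :=
  fun K ij => totalDegree_pderiv_le (hu K ij.1) ij.2

lemma add_mem_cellP {k : ℕ} {ι : Type} {u v : M.PwField ι} (hu : u ∈ M.cellP k ι)
    (hv : v ∈ M.cellP k ι) : u + v ∈ M.cellP k ι :=
  M.mem_cellSub.1 (add_mem (M.mem_cellSub.2 hu) (M.mem_cellSub.2 hv))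

theorem isGradRec_gradRec {k : ℕ} {v : M.PwField (Fin m) × M.FaceField (Fin m)}
    (hv : v ∈ M.V k m) : M.IsGradRec k v (M.gradRec k v) := by
  refine Classical.epsilon_spec (p := M.IsGradRec k v) ?_
  have hc : ∀ S i, Continuous (v.2 S i) := fun S i => continuous_of_mem_polyOn (hv.2 S i)
  obtain ⟨G, hG, h⟩ := M.exists_l2_eq (M.cellSub k (Fin m × Fin n))
    (-(M.l2L _ v.1 ∘ₗ M.pwDivL m) + M.faceFunctional v.2 hc M.jumpNormal M.continuous_jumpNormal
      M.jumpNormal_add M.jumpNormal_smul)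
  refine ⟨G, M.mem_cellSub.1 hG, fun τ hτ => ?_⟩
  rw [h τ (M.mem_cellSub.2 hτ)]
  simp only [M.intFace_comm _ (v.2 _)]
  rfl

theorem isDivRec_divRec {k : ℕ} {τ : M.PwField (Fin m × Fin n) × M.FaceField (Fin m)}
    (hτ : τ ∈ M.W k m) : M.IsDivRec k τ (M.divRec k τ) := by
  refine Classical.epsilon_spec (p := M.IsDivRec k τ) ?_
  have hc : ∀ S i, Continuous (τ.2 S i) := fun S i => continuous_of_mem_polyOn (hτ.2 S i)
  obtain ⟨d, hd, h⟩ := M.exists_l2_eq (M.cellSub k (Fin m))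
    (-(M.l2L _ τ.1 ∘ₗ M.pwGradL m) + M.faceFunctional τ.2 hc M.jumpTr M.continuous_jumpTr
      M.jumpTr_add M.jumpTr_smul)
  refine ⟨d, M.mem_cellSub.1 hd, fun φ hφ => ?_⟩
  rw [h φ (M.mem_cellSub.2 hφ), M.l2_comm (M.pwGrad φ)]
  rfl

/-- `Z(M)` as a subspace. -/
def ZSub (k m : ℕ) : Submodule ℝ (M.PwField (Fin m × Fin n)) where
  carrier := M.Z k m
  zero_mem' := ⟨M.mem_cellSub.1 (zero_mem _), fun w _ => M.l2_zero_left _⟩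
  add_mem' hu hv := ⟨M.add_mem_cellP hu.1 hv.1, fun w hw => by
    rw [M.l2_add_left, hu.2 w hw, hv.2 w hw, add_zero]⟩
  smul_mem' r u hu := ⟨M.mem_cellSub.1 ((M.cellSub k _).smul_mem r (M.mem_cellSub.2 hu.1)),
    fun w hw => by rw [M.l2_smul_left, hu.2 w hw, mul_zero]⟩

instance (k m : ℕ) : FiniteDimensional ℝ (M.ZSub k m) :=
  Submodule.finiteDimensional_of_le (S₂ := M.cellSub k (Fin m × Fin n))
    fun _ hu => M.mem_cellSub.2 hu.1

lemma exists_isProjZ (k : ℕ) (τ : M.PwField (Fin m × Fin n)) : ∃ z, M.IsProjZ k τ z := by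
  obtain ⟨z, hz, h⟩ := M.exists_l2_eq (M.ZSub k m) (M.l2L _ τ)
  exact ⟨z, hz, h⟩

/-- Equivalent defining predicates are equal, so the same element is chosen; uniqueness of the
projection is not needed. -/
lemma projZ_congr {k : ℕ} {τ τ' : M.PwField (Fin m × Fin n)}
    (h : ∀ ζ ∈ M.Z k m, M.l2 τ ζ = M.l2 τ' ζ) : M.projZ k τ = M.projZ k τ' := by
  have : M.IsProjZ k τ = M.IsProjZ k τ' := by
    ext z
    exact and_congr_right fun _ => forall₂_congr fun ζ hζ => by rw [h ζ hζ]
  rw [projZ, projZ, this]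

/-- The sum of a gradient $\mathrm D_{\mathrm{pw}}u$, where $u$ solves a piecewise Neumann problem,
and the projection of $\tau_{\mathcal M}$ onto $Z(\mathcal M)$. Orthogonality keeps the two
conditions independent. -/
theorem isDualRec_dualRec {k : ℕ} {τ : M.PwField (Fin m × Fin n) × M.FaceField (Fin m)}
    (hτ : τ ∈ M.W k m) : M.IsDualRec k τ (M.dualRec k τ) := by
  refine Classical.epsilon_spec (p := M.IsDualRec k τ) ?_
  have hc : ∀ S i, Continuous (τ.2 S i) := fun S i => continuous_of_mem_polyOn (hτ.2 S i)
  have hd := M.isDivRec_divRec hτ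
  obtain ⟨u, hu, h⟩ := exists_bilin_eq (M.cellSub (k + 1) (Fin m))
    ((M.l2L (Fin m × Fin n)).compl₁₂ (M.pwGradL m) (M.pwGradL m))
    (fun u w => M.l2_comm _ _)
    (-(M.l2L _ (M.divRec k τ)) + M.faceFunctional τ.2 hc M.jumpTr M.continuous_jumpTr
      M.jumpTr_add M.jumpTr_smul) fun w _ hw => by
    -- Compatibility: an isotropic `w` is piecewise constant, hence of degree at most `k` even for
    -- `k = 0`. It is admissible in the definition of $\operatorname{div}_h$, which says that the
    -- right-hand side vanishes on it.
    have hgrad : M.pwGrad w = 0 := M.eq_zero_of_l2_self hw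
    have hwk : w ∈ M.cellP k (Fin m) := fun K i => by
      have hp : ∀ j, MvPolynomial.pderiv j (w K i) = 0 := fun j =>
        congrFun (congrFun hgrad K) (i, j)
      exact (totalDegree_eq_zero_of_pderiv hp).trans_le (Nat.zero_le k)
    have := hd.2 w hwk
    rw [hgrad, M.l2_zero_left, neg_zero, zero_add] at this
    change -M.l2 (M.divRec k τ) w + ∑ S, M.intFace S (M.jumpTr w S) (τ.2 S) = 0
    rw [this, neg_add_cancel]
  obtain ⟨z, hz, hzτ⟩ := M.exists_isProjZ k τ.1
  have hu' := M.mem_cellSub.1 hu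
  refine ⟨M.pwGrad u + z, M.add_mem_cellP (M.pwGrad_mem_cellP hu') hz.1, fun w hw => ?_, ?_⟩
  · rw [M.l2_add_left, hz.2 w hw, add_zero, M.l2_comm w]
    exact h w (M.mem_cellSub.2 hw)
  · refine M.projZ_congr fun ζ hζ => ?_
    rw [M.l2_add_left, hzτ ζ hζ, M.l2_comm, hζ.2 u hu', zero_add]

end Reconstruction

end Mesh


/-! ### Splitting jumps of products, and the discrete integration by parts -/

namespace Mesh

variable {n : ℕ} {Ω : Set (EuclideanSpace ℝ (Fin n))} (M : Mesh n Ω)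

/-- The product rule `[ab] = [a]{b} + {a}[b]` on interior faces. -/
lemma jump_mul_of_interior {S : Fin M.L} (h : M.minus S ≠ none) (f g : Fin M.N → ℝ) :
    M.jump S (fun K => f K * g K) = M.jump S f * M.avg S g + M.avg S f * M.jump S g := by
  obtain ⟨K, hK⟩ := Option.ne_none_iff_exists'.1 h
  simp only [jump, avg, hK]
  ring

lemma integral_jump_of_interior {m : ℕ} {S : Fin M.L} (h : M.minus S ≠ none) {k l : ℕ}
    {v : M.PwField (Fin m)} (hv : v ∈ M.cellP l (Fin m)) {R : M.PwField (Fin m × Fin n)}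
    (hR : R ∈ M.cellP k (Fin m × Fin n)) :
    ∫ x : M.face S, ∑ i, M.jump S (fun K => ev (v K i) x * ∑ j, ev (R K (i, j)) x * M.normal S j)
        ∂μHE[n - 1] =
      M.intFace S (M.jumpTr v S) (M.avgNormal R S) +
        M.intFace S (M.avgTr v S) (M.jumpNormal R S) := by
  have h1 := fun i => continuous_of_mem_polyOn (M.jumpTr_mem_polyOn hv S i)
  have h2 := fun i => continuous_of_mem_polyOn (M.avgTr_mem_polyOn hv S i)
  have h3 := fun i => continuous_of_mem_polyOn (M.jumpNormal_mem_polyOn hR S i)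
  have h4 := fun i => continuous_of_mem_polyOn (M.avgNormal_mem_polyOn hR S i)
  rw [intFace, intFace, ← integral_add (M.integrable_face (by fun_prop))
    (M.integrable_face (by fun_prop))]
  simp only [M.jump_mul_of_interior h, Finset.sum_add_distrib]
  rfl

lemma integral_jump_of_boundary {m : ℕ} {S : Fin M.L} (h : M.minus S = none)
    (v : M.PwField (Fin m)) (R : M.PwField (Fin m × Fin n)) :
    (∫ x : M.face S, ∑ i, M.jump S (fun K => ev (v K i) x * ∑ j, ev (R K (i, j)) x * M.normal S j)
        ∂μHE[n - 1] = M.intFace S (M.jumpTr v S) (M.avgNormal R S)) ∧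
    (∫ x : M.face S, ∑ i, M.jump S (fun K => ev (v K i) x * ∑ j, ev (R K (i, j)) x * M.normal S j)
        ∂μHE[n - 1] = M.intFace S (M.avgTr v S) (M.jumpNormal R S)) := by
  constructor <;> simp only [intFace, jumpTr, avgTr, jumpNormal, avgNormal, jump, avg, h]

end Mesh

end HHO

end

theorem lemma3p2 {n m k : ℕ} {Ω : Set (EuclideanSpace ℝ (Fin n))}
    (hΩ : interior (closure Ω) = Ω)
    (ΓD : Set (EuclideanSpace ℝ (Fin n))) (hΓD : ΓD ⊆ frontier Ω)
    (M : HHO.Mesh n Ω)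
    (vh : M.PwField (Fin m) × M.FaceField (Fin m)) (hv : vh ∈ M.VD ΓD k m)
    (τh : M.PwField (Fin m × Fin n) × M.FaceField (Fin m)) (hτ : τh ∈ M.WN ΓD k m) :
    M.l2 (M.gradRec k vh) (M.dualRec k τh) =
      ∑ S ∈ (M.dirichlet ΓD)ᶜ,
        M.intFace S (vh.2 S - M.faceProj k S (M.avgTr vh.1 S))
          (M.jumpNormal (M.dualRec k τh) S)
      + ∑ S ∈ (M.neumann ΓD)ᶜ,
        M.intFace S (M.faceProj k S (M.jumpTr vh.1 S))
          (τh.2 S - M.avgNormal (M.dualRec k τh) S)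
      - M.l2 vh.1 (M.divRec k τh) := by
  obtain ⟨hvV, hvD⟩ := hv
  obtain ⟨hτW, hτN⟩ := hτ
  obtain ⟨hR, hRgrad, -⟩ := M.isDualRec_dualRec hτW
  set R := M.dualRec k τh
  -- These three identities determine the left-hand side up to face integrals; they are combined
  -- linearly at the end.
  have hG := (M.isGradRec_gradRec hvV).2 R hR
  have hparts := M.l2_pwGrad_add_l2_pwDiv hΩ vh.1 R
  have hdual := hRgrad vh.1 hvV.1
  rw [M.l2_comm] at hdual
  have hv2 := fun S i => HHO.Mesh.continuous_of_mem_polyOn (hvV.2 S i)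
  have hτ2 := fun S i => HHO.Mesh.continuous_of_mem_polyOn (hτW.2 S i)
  have hJ := fun S i => HHO.Mesh.continuous_of_mem_polyOn (M.jumpNormal_mem_polyOn hR S i)
  have hA := fun S i => HHO.Mesh.continuous_of_mem_polyOn (M.avgNormal_mem_polyOn hR S i)
  have hD : ∀ S, M.intFace S (vh.2 S - M.faceProj k S (M.avgTr vh.1 S)) (M.jumpNormal R S) =
      M.intFace S (vh.2 S) (M.jumpNormal R S) -
        M.intFace S (M.avgTr vh.1 S) (M.jumpNormal R S) := fun S => by
    have hf := M.avgTr_mem_polyOn hvV.1 S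
    rw [M.intFace_sub_left S (hv2 S)
      (fun i => HHO.Mesh.continuous_of_mem_polyOn (M.isFaceProj_faceProj k hf i).1) (hJ S),
      M.intFace_faceProj hf (M.jumpNormal_mem_polyOn hR S)]
  have hN : ∀ S, M.intFace S (M.faceProj k S (M.jumpTr vh.1 S)) (τh.2 S - M.avgNormal R S) =
      M.intFace S (M.jumpTr vh.1 S) (τh.2 S) -
        M.intFace S (M.jumpTr vh.1 S) (M.avgNormal R S) := fun S => by
    have hf := M.jumpTr_mem_polyOn hvV.1 S
    have hp := fun i => HHO.Mesh.continuous_of_mem_polyOn (M.isFaceProj_faceProj k hf i).1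
    rw [M.intFace_comm, M.intFace_sub_left S (hτ2 S) (hA S) hp, M.intFace_comm S (τh.2 S),
      M.intFace_comm S (M.avgNormal R S), M.intFace_faceProj hf (hτW.2 S),
      M.intFace_faceProj hf (M.avgNormal_mem_polyOn hR S)]
  -- Extending both sums by zero to all faces allows a comparison face by face.
  have hsum : ∀ (A : Finset (Fin M.L)) (f : Fin M.L → ℝ),
      ∑ S ∈ Aᶜ, f S = ∑ S, if S ∈ A then 0 else f S := fun A f => by
    rw [← Finset.sum_compl_add_sum A (fun S => if S ∈ A then 0 else f S),
      Finset.sum_eq_zero fun S hS => if_pos hS, add_zero]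
    exact Finset.sum_congr rfl fun S hS => (if_neg (Finset.mem_compl.1 hS)).symm
  have hface : ∑ S, ((if S ∈ M.dirichlet ΓD then 0 else
        M.intFace S (vh.2 S) (M.jumpNormal R S) - M.intFace S (M.avgTr vh.1 S) (M.jumpNormal R S)) +
      (if S ∈ M.neumann ΓD then 0 else M.intFace S (M.jumpTr vh.1 S) (τh.2 S) -
        M.intFace S (M.jumpTr vh.1 S) (M.avgNormal R S))) =
      ∑ S, (M.intFace S (vh.2 S) (M.jumpNormal R S) + M.intFace S (M.jumpTr vh.1 S) (τh.2 S) -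
        ∫ x : M.face S, ∑ i, M.jump S (fun K => HHO.ev (vh.1 K i) x *
          ∑ j, HHO.ev (R K (i, j)) x * M.normal S j) ∂μHE[n - 1]) := by
    refine Finset.sum_congr rfl fun S _ => ?_
    by_cases hSD : S ∈ M.dirichlet ΓD
    · have hSN : S ∉ M.neumann ΓD := by simp [HHO.Mesh.neumann, hSD]
      -- Without this, a Dirichlet face could be an interior one, and the term $\{v_{\mathcal
      -- M}\}\cdot[R\nu_S]$ of the product rule would be missing.
      have hb := M.minus_eq_none_of_mem_dirichlet hΩ hΓD hSD
      rw [if_pos hSD, if_neg hSN, (M.integral_jump_of_boundary hb vh.1 R).1,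
        M.intFace_zero_left S (hvD S hSD)]
      ring
    by_cases hSN : S ∈ M.neumann ΓD
    · have hb : M.minus S = none := by
        simp only [HHO.Mesh.neumann, Set.Finite.mem_toFinset] at hSN
        exact hSN.1
      rw [if_neg hSD, if_pos hSN, (M.integral_jump_of_boundary hb vh.1 R).2,
        M.intFace_comm S _ (τh.2 S), M.intFace_zero_left S (hτN S hSN)]
      ring
    · have hi : M.minus S ≠ none := fun h => hSN (by
        simp only [HHO.Mesh.neumann, Set.Finite.mem_toFinset]
        exact ⟨h, hSD⟩)
      rw [if_neg hSD, if_neg hSN, M.integral_jump_of_interior hi hvV.1 hR]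
      ring
  rw [Finset.sum_congr rfl fun S _ => hD S, Finset.sum_congr rfl fun S _ => hN S, hsum, hsum,
    ← Finset.sum_add_distrib, hface, Finset.sum_sub_distrib, Finset.sum_add_distrib]
  linarith
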